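/- Let $d\ge 1$ and let $\Omega\subset\mathbb{R}^d$ be a bounded or unbounded domain. If $\partial\Omega\neq\emptyset$, assume that $\partial\Omega\in C^2$ and that for some $\tau_0>0$ the following holds, where $\nu(p)$ is the unit inward normal at $p\in\partial\Omega$ and $\Pi(\tau_0):=\{x\in\Omega:\ \operatorname{dist}(x,\partial\Omega)\le\tau_0\}$: the map $(p,\tau)\mapsto p+\tau\nu(p)$ is a bijection of $\partial\Omega\times(0,\tau_0]$ onto $\Pi(\tau_0)$, and $\partial\Omega$ is covered by local $C^2$ parametrizations with parameters $s\in\mathbb{R}^{d-1}$ such that, on $\Pi(\tau_0)$, the first derivatives of $x$ with respect to $(\tau,s)$ are bounded, and the Jacobians of the passage $(\tau,s)\mapsto x$ are bounded and separated from zero, uniformly over all points and parametrizations. Let $\mathbb{M}_n$ be the space of complex $n\times n$ matrices, $|A|:=\sum_{i,j}|a_{ij}|$, and let $L_\infty(\Omega;\mathbb{M}_n)$ have the norm $\||A|\|_{L_\infty(\Omega)}$. Let $\mathfrak{V}$ be either $W_2^1(\Omega;\mathbb{C}^n)$ or its subspace of functions with zero trace on $\partial\Omega$, with the norm of $W_2^1(\Omega;\mathbb{C}^n)$.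 Let $\mathfrak{M}_{1,-1}$ be the space of multipliers from $\mathfrak{V}$ into the space $\mathfrak{V}^*$ of continuous antilinear functionals on $\mathfrak{V}$, with the norm $$\|V\|_{\mathfrak{M}_{1,-1}}:=\sup_{u,v\in\mathfrak{V},\ u,v\neq0}\frac{|\langle Vu,v\rangle|}{\|u\|_{\mathfrak{V}}\|v\|_{\mathfrak{V}}},\qquad \langle Vu,v\rangle=(Vu,v)_{L_2(\Omega;\mathbb{C}^n)}\ \text{ for } V\in L_\infty(\Omega;\mathbb{M}_n).$$ Let $\omega\subset\mathbb{R}^d$ be a fixed bounded domain, and let $\varepsilon\to0$ be a small parameter ranging over a set $E\subset\mathbb{R}^m\setminus\{0\}$ with $0\in\overline{E}$. Let $V^\varepsilon\in L_\infty(\Omega;\mathbb{M}_n)$, $\varepsilon\in E$, be a family bounded in $L_\infty(\Omega;\mathbb{M}_n)$ uniformly in $\varepsilon$. Let $\mu(\varepsilon)>0$ and $\rho_2(\varepsilon)\ge0$ be functions on $E$ with $\mu(\varepsilon)\to0$ and $\rho_2(\varepsilon)\to0$ as $\varepsilon\to0$. Suppose that for almost every $x\in\Omega$ there exists the finite limit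 $$V^0(x):=\lim_{\varepsilon\to0}\frac{1}{\mu^d(\varepsilon)\operatorname{mes}\omega}\int_{x+\mu(\varepsilon)\omega}V^\varepsilon(y)\,dy,$$ and that it is uniform in the sense that for each $\varepsilon\in E$ $$\bigg|V^0(x)-\frac{1}{\mu^d(\varepsilon)\operatorname{mes}\omega}\int_{x+\mu(\varepsilon)\omega}V^\varepsilon(y)\,dy\bigg|\le\rho_2(\varepsilon)$$ for almost every $x\in\Omega$ such that $x+\mu(\varepsilon)\omega\subset\Omega$. Then $V^0\in L_\infty(\Omega;\mathbb{M}_n)$, the family $V^\varepsilon$ converges to $V^0$ in $\mathfrak{M}_{1,-1}$ as $\varepsilon\to0$, and for all $\varepsilon\in E$ $$\|V^\varepsilon-V^0\|_{\mathfrak{M}_{1,-1}}\le C\big(\rho_2(\varepsilon)+\mu^{1/2}(\varepsilon)\big),$$ where $C$ is a constant independent of $\varepsilon$, $\mu$ and $\rho_2$. -/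

import Mathlib

open MeasureTheory Set Filter Topology
open scoped ENNReal NNReal

noncomputable section

namespace Homog

/-- The Euclidean space `ℝ^d`. -/
abbrev Rd (d : ℕ) := EuclideanSpace ℝ (Fin d)

/-- The Hermitian space `ℂ^n`. -/
abbrev Cn (n : ℕ) := EuclideanSpace ℂ (Fin n)

/-- The space of complex `n × n` matrices. -/
abbrev Mat (n : ℕ) := Matrix (Fin n) (Fin n) ℂ

/-- A domain: a nonempty connected open set. -/
def IsDomainSet {d : ℕ} (Ω : Set (Rd d)) : Prop := IsOpen Ω ∧ IsConnected Ω

/-! ### Regularity of the boundary -/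

/-- `f` is a `C²` defining function of `Ω` in the open neighbourhood `U` of `p`: its gradient does
not vanish and `Ω ∩ U = {f > 0}`. -/
def IsDefiningFunction {d : ℕ} (Ω : Set (Rd d)) (p : Rd d) (U : Set (Rd d)) (f : Rd d → ℝ) : Prop :=
  IsOpen U ∧ p ∈ U ∧ ContDiffOn ℝ 2 f U ∧ (∀ x ∈ U, gradient f x ≠ 0) ∧
    Ω ∩ U = {x | x ∈ U ∧ 0 < f x}

/-- The boundary of `Ω` is of class `C²` (and `Ω` lies locally on one side of it). -/
def HasC2Boundary {d : ℕ} (Ω : Set (Rd d)) : Prop :=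
  ∀ p ∈ frontier Ω, ∃ U f, IsDefiningFunction Ω p U f

/-- `ν` is the unit inward normal to `∂Ω` at the boundary point `p`. -/
def IsInwardNormal {d : ℕ} (Ω : Set (Rd d)) (p ν : Rd d) : Prop :=
  ∃ U f, IsDefiningFunction Ω p U f ∧ ν = ‖gradient f p‖⁻¹ • gradient f p

/-- The boundary layer `Π(t) = {x ∈ Ω : dist(x, ∂Ω) ≤ t}`. -/
def boundaryLayer {d : ℕ} (Ω : Set (Rd d)) (t : ℝ) : Set (Rd d) :=
  {x | x ∈ Ω ∧ Metric.infDist x (frontier Ω) ≤ t}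

/-- The space `ℝ^(d-1)` of the local variables `s` on the boundary. -/
abbrev TangentialSpace (d : ℕ) [NeZero d] := EuclideanSpace ℝ {i : Fin d // i ≠ 0}

/-- The tangential part `s` of `y = (τ, s) ∈ ℝ^d`; the normal part is `τ = y 0`. -/
def tangentialPart {d : ℕ} [NeZero d] (y : Rd d) : TangentialSpace d :=
  WithLp.toLp 2 (fun i => y i.1)

/-- The passage `(τ, s) ↦ x = φ(s) + τ ν(φ(s))` from the normal coordinates to `x`, for a local
parametrization `φ` of the boundary. -/
def normalCoordinateMap {d : ℕ} [NeZero d] (ν : Rd d → Rd d) (φ : TangentialSpace d → Rd d)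
    (y : Rd d) : Rd d :=
  φ (tangentialPart y) + y 0 • ν (φ (tangentialPart y))

/-- The standing assumption on a nonempty boundary: for some `τ₀ > 0`, the distance `τ` along the
inward normal is well defined on `Π(τ₀)`, that is, `(p, τ) ↦ p + τ ν(p)` is a bijection of
`∂Ω × (0, τ₀]` onto `Π(τ₀)`; and `∂Ω` is covered by local `C²` parametrizations `s ↦ φ(s)` for which
the first derivatives of `x` in `(τ, s)` are bounded, and the Jacobians are bounded and separated
from zero, by the same constants. -/
def HasUniformNormalCoordinates {d : ℕ} [NeZero d] (Ω : Set (Rd d)) : Prop :=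
  ∃ (τ₀ : ℝ) (ν : Rd d → Rd d), 0 < τ₀ ∧
    (∀ p ∈ frontier Ω, IsInwardNormal Ω p (ν p)) ∧
    BijOn (fun q : Rd d × ℝ => q.1 + q.2 • ν q.1) (frontier Ω ×ˢ Ioc 0 τ₀) (boundaryLayer Ω τ₀) ∧
    ∃ c K : ℝ, 0 < c ∧
      ∀ p ∈ frontier Ω, ∃ (S : Set (TangentialSpace d)) (φ : TangentialSpace d → Rd d),
        IsOpen S ∧ ContDiffOn ℝ 2 φ S ∧ InjOn φ S ∧ MapsTo φ S (frontier Ω) ∧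
        φ '' S ∈ 𝓝[frontier Ω] p ∧
        ∀ y : Rd d, tangentialPart y ∈ S → y 0 ∈ Ioc 0 τ₀ →
          ‖fderiv ℝ (normalCoordinateMap ν φ) y‖ ≤ K ∧
          c ≤ |(fderiv ℝ (normalCoordinateMap ν φ) y).det| ∧
          |(fderiv ℝ (normalCoordinateMap ν φ) y).det| ≤ K

/-! ### Bounded matrix functions -/

/-- `|A| = ∑ |a_ij|`. -/
def matAbs {n : ℕ} (A : Mat n) : ℝ := ∑ i, ∑ j, ‖A i j‖

/-- `V ∈ L_∞(Ω; M_n)`: every entry is in `L_∞(Ω)`. -/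
def MemLinfty {d n : ℕ} (Ω : Set (Rd d)) (V : Rd d → Mat n) : Prop :=
  ∀ i j, MemLp (fun x => V x i j) ∞ (volume.restrict Ω)

/-- The norm of `L_∞(Ω; M_n)`. -/
def linftyNorm {d n : ℕ} (Ω : Set (Rd d)) (V : Rd d → Mat n) : ℝ≥0∞ :=
  eLpNorm (fun x => matAbs (V x)) ∞ (volume.restrict Ω)

/-- The set `x + r ω`. -/
def scaledSet {d : ℕ} (ω : Set (Rd d)) (r : ℝ) (x : Rd d) : Set (Rd d) :=
  (fun z => x + r • z) '' ω

/-- The entrywise average `(r^d mes ω)⁻¹ ∫_{x + r ω} V(y) dy`. -/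
def scaledAverage {d n : ℕ} (ω : Set (Rd d)) (r : ℝ) (V : Rd d → Mat n) (x : Rd d) : Mat n :=
  Matrix.of fun i j =>
    ((r ^ d * volume.real ω : ℝ) : ℂ)⁻¹ * ∫ y in scaledSet ω r x, V y i j

/-! ### Sobolev spaces -/

/-- The partial derivative in the `i`-th coordinate. -/
def partialDeriv {d : ℕ} {F : Type*} [NormedAddCommGroup F] [NormedSpace ℝ F] (i : Fin d)
    (f : Rd d → F) (x : Rd d) : F :=
  fderiv ℝ f x (EuclideanSpace.single i 1)

/-- `g` is the weak derivative of `u` in the `i`-th coordinate on `Ω`. -/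
def IsWeakPartialDeriv {d n : ℕ} (Ω : Set (Rd d)) (i : Fin d) (u g : Rd d → Cn n) : Prop :=
  ∀ ψ : Rd d → ℝ, ContDiff ℝ (⊤ : ℕ∞) ψ → HasCompactSupport ψ → tsupport ψ ⊆ Ω →
    ∫ x in Ω, partialDeriv i ψ x • u x = - ∫ x in Ω, ψ x • g x

/-- An element of `W_2^1(Ω; ℂ^n)`: a square integrable function with square integrable weak
derivatives. The derivatives are kept as data; they are unique almost everywhere on `Ω`. -/
structure SobolevFun {d : ℕ} (Ω : Set (Rd d)) (n : ℕ) where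
  toFun : Rd d → Cn n
  grad : Fin d → Rd d → Cn n
  memLp : MemLp toFun 2 (volume.restrict Ω)
  memLp_grad : ∀ i, MemLp (grad i) 2 (volume.restrict Ω)
  weakDeriv : ∀ i, IsWeakPartialDeriv Ω i toFun (grad i)

/-- The norm of `W_2^1(Ω; ℂ^n)`. -/
def SobolevFun.sobolevNorm {d n : ℕ} {Ω : Set (Rd d)} (u : SobolevFun Ω n) : ℝ :=
  Real.sqrt ((∫ x in Ω, ‖u.toFun x‖ ^ 2) + ∑ i, ∫ x in Ω, ‖u.grad i x‖ ^ 2)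

/-- `g` is the trace of `u ∈ W_2^1(Ω; ℂ^n)` on `∂Ω`: there are smooth compactly supported functions
on `ℝ^d` that converge to `u` in `W_2^1(Ω; ℂ^n)` and to `g` in `L_2(∂Ω; ℂ^n)`. -/
def SobolevFun.HasTrace {d n : ℕ} {Ω : Set (Rd d)} (u : SobolevFun Ω n) (g : Rd d → Cn n) : Prop :=
  ∃ ψ : ℕ → Rd d → Cn n, (∀ k, ContDiff ℝ (⊤ : ℕ∞) (ψ k) ∧ HasCompactSupport (ψ k)) ∧
    Tendsto (fun k => eLpNorm (fun x => ψ k x - u.toFun x) 2 (volume.restrict Ω)) atTop (𝓝 0) ∧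
    (∀ i, Tendsto (fun k => eLpNorm (fun x => partialDeriv i (ψ k) x - u.grad i x) 2
      (volume.restrict Ω)) atTop (𝓝 0)) ∧
    Tendsto (fun k => eLpNorm (fun x => ψ k x - g x) 2
      ((Measure.hausdorffMeasure ((d : ℝ) - 1)).restrict (frontier Ω))) atTop (𝓝 0)

/-- The two admissible boundary conditions. -/
inductive BoundaryCondition
  | dirichlet
  | robin

/-- The form domain: `W_2^1(Ω; ℂ^n)` for the Robin condition, and its subspace of functions with
zero trace for the Dirichlet condition. -/
def formDomain {d : ℕ} (Ω : Set (Rd d)) (n : ℕ) : BoundaryCondition → Set (SobolevFun Ω n)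
  | .dirichlet => {u | u.HasTrace (fun _ => 0)}
  | .robin => univ

/-! ### Multipliers from the form domain into its adjoint space -/

/-- `⟨V u, v⟩ = (V u, v)` in `L_2(Ω; ℂ^n)`, linear in `u` and antilinear in `v`. -/
def multiplierPairing {d n : ℕ} {Ω : Set (Rd d)} (V : Rd d → Mat n) (u v : SobolevFun Ω n) : ℂ :=
  ∫ x in Ω, inner ℂ (v.toFun x) (Matrix.toEuclideanLin (V x) (u.toFun x))

/-- The norm of a bounded matrix function `V` as a multiplier from the form domain into its
adjoint space: the supremum of `|⟨V u, v⟩| / (‖u‖ ‖v‖)` over nonzero `u`, `v`. -/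
def multiplierNorm {d n : ℕ} (Ω : Set (Rd d)) (bc : BoundaryCondition) (V : Rd d → Mat n) : ℝ≥0∞ :=
  ⨆ u ∈ formDomain Ω n bc, ⨆ v ∈ formDomain Ω n bc,
    ⨆ (_ : u.sobolevNorm ≠ 0) (_ : v.sobolevNorm ≠ 0),
      ENNReal.ofReal (‖multiplierPairing V u v‖ / (u.sobolevNorm * v.sobolevNorm))

/-- Convergence in the space of multipliers, for a family of bounded matrix functions that is
indexed by `ε ∈ E`, as `ε → 0`. -/
def ConvergesAsMultipliers {d n m : ℕ} (Ω : Set (Rd d)) (bc : BoundaryCondition)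
    (E : Set (EuclideanSpace ℝ (Fin m))) (V : EuclideanSpace ℝ (Fin m) → Rd d → Mat n)
    (V₀ : Rd d → Mat n) : Prop :=
  (∀ ε ∈ E, multiplierNorm Ω bc (V ε) < ∞) ∧ multiplierNorm Ω bc V₀ < ∞ ∧
    Tendsto (fun ε => multiplierNorm Ω bc (fun x => V ε x - V₀ x)) (𝓝[E] 0) (𝓝 0)

end Homog

end

/-! The matrix problem is scalar: the pairing of `V ε - V₀` with `u`, `v` is a sum of `n ^ 2`
integrals of `f - f₀` against `G = u_j * conj v_i`, with `f`, `f₀` bounded entries. Let `R` bound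
the norms of the points of `ω`, put `t = 2 * R * μ`, and let `D = innerPart Ω t` be the points at
distance at least `t` from the complement. For `x` in `D` the set `x + μ ω` lies in `Ω`, and `f -
f₀` splits as `(f - A) + (A - f₀)`, where `A` is the local average of `f`. The second summand is at
most `ρ₂` by hypothesis.

For the first, write `A` as an average of `f (x + h)` over a probability measure of shifts `h` and
exchange the integrals. For each shift, `(f x - f (x + h)) * G x = (f x * G x - f (x + h) * G (x +
h)) + f (x + h) * (G (x + h) - G x)`. The first bracket integrates over `D` to a quantity living in
a strip of width `2 * t` near the boundary. The last term is controlled because a Sobolev function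
changes in `L₂` by at most `‖h‖` times its norm under a shift
(`SobolevFun.lintegral_translate_sub_le`). The same strip estimate handles `Ω \ D`.

So everything rests on one trace-type bound: the `L₂` norm of a Sobolev function over a strip of
width `t` is `O(√t)` (`exists_lintegral_boundary_strip_le`). It follows by comparing a value near
the boundary with its averages along the inward normal and changing variables through normal
coordinates. The product `G` then has `L₁` norm `O(t)` on the strip, so the argument gives an error
of order `ρ₂ + μ`; this implies the stated rate for `μ ≤ 1`, and for `μ ≥ 1` boundedness suffices.

Smooth approximation is used only in the interior. Moving along the inward normal increases the
distance to the complement, so the strip estimate can be proved inside `innerPart Ω s` uniformly in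
`s` and passed to the limit `s → 0`. All bounds hold on the whole Sobolev space, hence for both
boundary conditions. -/

namespace Homog

/-! ### Cauchy–Schwarz and Jensen for extended nonnegative functions. -/

section CauchySchwarz

variable {α : Type*} [MeasurableSpace α] {μ : Measure α}

/-- The Cauchy–Schwarz inequality for the Lebesgue integral of `ℝ≥0∞`-valued functions. -/
theorem lintegral_mul_sq_le {f g : α → ℝ≥0∞} (hf : AEMeasurable f μ) (hg : AEMeasurable g μ) :
    (∫⁻ a, f a * g a ∂μ) ^ 2 ≤ (∫⁻ a, f a ^ 2 ∂μ) * ∫⁻ a, g a ^ 2 ∂μ := by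
  have h := ENNReal.lintegral_mul_le_Lp_mul_Lq μ Real.HolderConjugate.two_two hf hg
  simp only [Pi.mul_apply, ENNReal.rpow_two] at h
  have h2 : ∀ x : ℝ≥0∞, (x ^ (1 / (2 : ℝ))) ^ 2 = x := fun x => by
    rw [← ENNReal.rpow_natCast, ← ENNReal.rpow_mul]; norm_num
  calc (∫⁻ a, f a * g a ∂μ) ^ 2
      ≤ ((∫⁻ a, f a ^ 2 ∂μ) ^ (1 / (2 : ℝ)) * (∫⁻ a, g a ^ 2 ∂μ) ^ (1 / (2 : ℝ))) ^ 2 := by gcongr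
    _ = _ := by rw [mul_pow, h2, h2]

theorem lintegral_mul_le_ofReal {f g : α → ℝ≥0∞} (hf : AEMeasurable f μ) (hg : AEMeasurable g μ)
    {A B : ℝ} (hA : 0 ≤ A) (hB : 0 ≤ B) (h1 : ∫⁻ a, f a ^ 2 ∂μ ≤ ENNReal.ofReal (A ^ 2))
    (h2 : ∫⁻ a, g a ^ 2 ∂μ ≤ ENNReal.ofReal (B ^ 2)) :
    ∫⁻ a, f a * g a ∂μ ≤ ENNReal.ofReal (A * B) := by
  rw [← ENNReal.pow_le_pow_left_iff (n := 2) two_ne_zero]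
  refine (lintegral_mul_sq_le hf hg).trans ((mul_le_mul' h1 h2).trans ?_)
  rw [← ENNReal.ofReal_mul (by positivity), ← ENNReal.ofReal_pow (by positivity), mul_pow]

/-- Jensen's inequality for the square, with a weight. -/
theorem lintegral_weight_mul_sq_le {w f : α → ℝ≥0∞} (hw : AEMeasurable w μ) (hf : AEMeasurable f μ) :
    (∫⁻ a, w a * f a ∂μ) ^ 2 ≤ (∫⁻ a, w a ∂μ) * ∫⁻ a, w a * f a ^ 2 ∂μ := by
  have h2 : ∀ x : ℝ≥0∞, (x ^ (1 / (2 : ℝ))) ^ 2 = x := fun x => by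
    rw [← ENNReal.rpow_natCast, ← ENNReal.rpow_mul]; norm_num
  -- The weight is shared between the two factors: `w * f = √w * (√w * f)`.
  have h := lintegral_mul_sq_le (μ := μ) (f := fun a => w a ^ (1 / (2 : ℝ)))
    (g := fun a => w a ^ (1 / (2 : ℝ)) * f a) (by fun_prop) (by fun_prop)
  simp only [mul_pow, h2] at h
  simpa only [← mul_assoc, ← sq, h2] using h

end CauchySchwarz

/-! ### The Sobolev norm as a Lebesgue integral. -/

section Sobolev

variable {d n : ℕ} {Ω : Set (Rd d)}

theorem SobolevFun.sobolevNorm_nonneg (u : SobolevFun Ω n) : 0 ≤ u.sobolevNorm :=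
  Real.sqrt_nonneg _

theorem ofReal_integral_norm_sq {α E : Type*} [MeasurableSpace α] [NormedAddCommGroup E]
    {μ : Measure α} {f : α → E} (hf : MemLp f 2 μ) :
    ENNReal.ofReal (∫ x, ‖f x‖ ^ 2 ∂μ) = ∫⁻ x, ‖f x‖ₑ ^ 2 ∂μ := by
  rw [ofReal_integral_eq_lintegral_ofReal (hf.integrable_norm_pow two_ne_zero)
    (ae_of_all _ fun x => by positivity)]
  refine lintegral_congr fun x => ?_
  rw [ENNReal.ofReal_pow (norm_nonneg _), ofReal_norm]

theorem SobolevFun.ofReal_sobolevNorm_sq (u : SobolevFun Ω n) :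
    ENNReal.ofReal (u.sobolevNorm ^ 2) =
      (∫⁻ x in Ω, ‖u.toFun x‖ₑ ^ 2) + ∑ i, ∫⁻ x in Ω, ‖u.grad i x‖ₑ ^ 2 := by
  have h0 : 0 ≤ ∫ x in Ω, ‖u.toFun x‖ ^ 2 := integral_nonneg fun x => by positivity
  have h1 : ∀ i ∈ Finset.univ, 0 ≤ ∫ x in Ω, ‖u.grad i x‖ ^ 2 :=
    fun i _ => integral_nonneg fun x => by positivity
  rw [SobolevFun.sobolevNorm, Real.sq_sqrt (add_nonneg h0 (Finset.sum_nonneg h1)),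
    ENNReal.ofReal_add h0 (Finset.sum_nonneg h1), ENNReal.ofReal_sum_of_nonneg h1,
    ofReal_integral_norm_sq u.memLp]
  simp only [ofReal_integral_norm_sq (u.memLp_grad _)]

theorem SobolevFun.lintegral_toFun_le (u : SobolevFun Ω n) :
    ∫⁻ x in Ω, ‖u.toFun x‖ₑ ^ 2 ≤ ENNReal.ofReal (u.sobolevNorm ^ 2) := by
  rw [u.ofReal_sobolevNorm_sq]; exact le_self_add

theorem SobolevFun.lintegral_grad_le (u : SobolevFun Ω n) :
    ∑ i, ∫⁻ x in Ω, ‖u.grad i x‖ₑ ^ 2 ≤ ENNReal.ofReal (u.sobolevNorm ^ 2) := by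
  rw [u.ofReal_sobolevNorm_sq]; exact le_add_self

end Sobolev

/-! ### Interior smooth approximation by mollification. -/

section Mollification

variable {d n : ℕ} {Ω : Set (Rd d)}

open ContinuousLinearMap in
/-- Young's inequality for the convolution of a square integrable function with a normed bump
function. -/
theorem lintegral_enorm_sq_mollify_le (φ : ContDiffBump (0 : Rd d)) {g : Rd d → Cn n}
    (hg : StronglyMeasurable g) :
    ∫⁻ x, ‖(convolution (φ.normed volume) g (lsmul ℝ ℝ) volume) x‖ₑ ^ 2 ≤ ∫⁻ x, ‖g x‖ₑ ^ 2 := by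
  have hφm : Measurable (φ.normed (volume : Measure (Rd d))) :=
    φ.continuous_normed.measurable
  have hmass : ∫⁻ t, ‖φ.normed (volume : Measure (Rd d)) t‖ₑ = 1 := by
    have := φ.integral_normed (μ := (volume : Measure (Rd d)))
    rw [← ofReal_integral_norm_eq_lintegral_enorm φ.integrable_normed]
    simp only [Real.norm_of_nonneg (φ.nonneg_normed _), this, ENNReal.ofReal_one]
  have hgm : Measurable g := hg.measurable
  calc ∫⁻ x, ‖(convolution (φ.normed volume) g (lsmul ℝ ℝ) volume) x‖ₑ ^ 2
      ≤ ∫⁻ x, ∫⁻ t, ‖φ.normed (volume : Measure (Rd d)) t‖ₑ * ‖g (x - t)‖ₑ ^ 2 := by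
        refine lintegral_mono fun x => ?_
        have h1 : ‖(convolution (φ.normed volume) g (lsmul ℝ ℝ) volume) x‖ₑ ≤
            ∫⁻ t, ‖φ.normed (volume : Measure (Rd d)) t‖ₑ * ‖g (x - t)‖ₑ := by
          refine (enorm_integral_le_lintegral_enorm _).trans_eq ?_
          simp [enorm_smul]
        -- The kernel has total mass one, so Jensen's inequality costs no constant.
        have h2 := lintegral_weight_mul_sq_le (μ := (volume : Measure (Rd d)))
          (w := fun t => ‖φ.normed (volume : Measure (Rd d)) t‖ₑ)
          (f := fun t => ‖g (x - t)‖ₑ) (by fun_prop) (by fun_prop)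
        rw [hmass, one_mul] at h2
        exact (by gcongr : _ ≤ _).trans h2
    _ = ∫⁻ t, ∫⁻ x, ‖φ.normed (volume : Measure (Rd d)) t‖ₑ * ‖g (x - t)‖ₑ ^ 2 :=
        lintegral_lintegral_swap (by unfold Function.uncurry; fun_prop)
    _ = ∫⁻ t, ‖φ.normed (volume : Measure (Rd d)) t‖ₑ * ∫⁻ x, ‖g x‖ₑ ^ 2 := by
        refine lintegral_congr fun t => ?_
        rw [lintegral_const_mul _ (by fun_prop),
          lintegral_sub_right_eq_self (fun x => ‖g x‖ₑ ^ 2) t]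
    _ = ∫⁻ x, ‖g x‖ₑ ^ 2 := by
        rw [lintegral_mul_const _ (by fun_prop), hmass, one_mul]

/-- A representative of a square integrable function on `Ω`, extended by zero. -/
theorem exists_stronglyMeasurable_extension (hΩ : MeasurableSet Ω) {u : Rd d → Cn n}
    (hu : MemLp u 2 (volume.restrict Ω)) :
    ∃ w : Rd d → Cn n, StronglyMeasurable w ∧ w =ᵐ[volume.restrict Ω] u ∧ (∀ x ∉ Ω, w x = 0) ∧
      MemLp w 2 volume ∧ ∫⁻ x, ‖w x‖ₑ ^ 2 = ∫⁻ x in Ω, ‖u x‖ₑ ^ 2 := by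
  have hae : Ω.indicator (hu.1.mk u) =ᵐ[volume.restrict Ω] u :=
    (indicator_ae_eq_restrict hΩ).trans hu.1.ae_eq_mk.symm
  refine ⟨Ω.indicator (hu.1.mk u), hu.1.stronglyMeasurable_mk.indicator hΩ, hae,
    fun x hx => indicator_of_notMem hx _, ?_, ?_⟩
  · rw [memLp_indicator_iff_restrict hΩ]
    exact (memLp_congr_ae hu.1.ae_eq_mk.symm).2 hu
  · have h1 : (fun x => ‖Ω.indicator (hu.1.mk u) x‖ₑ ^ 2) =
        Ω.indicator (fun x => ‖hu.1.mk u x‖ₑ ^ 2) := by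
      ext x
      by_cases hx : x ∈ Ω <;> simp [hx]
    rw [h1, lintegral_indicator hΩ]
    refine lintegral_congr_ae ?_
    filter_upwards [hu.1.ae_eq_mk] with x hx
    rw [hx]

open ContinuousLinearMap in
/-- The derivative of a mollified function is the mollified weak derivative, away from the
boundary. -/
theorem partialDeriv_mollify (φ : ContDiffBump (0 : Rd d)) {i : Fin d}
    {u g w v : Rd d → Cn n} (hug : IsWeakPartialDeriv Ω i u g)
    (hw : w =ᵐ[volume.restrict Ω] u) (hw0 : ∀ x ∉ Ω, w x = 0) (hwi : LocallyIntegrable w)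
    (hv : v =ᵐ[volume.restrict Ω] g) (hv0 : ∀ x ∉ Ω, v x = 0) {x : Rd d}
    (hx : Metric.closedBall x φ.rOut ⊆ Ω) :
    partialDeriv i (convolution (φ.normed volume) w (lsmul ℝ ℝ) volume) x =
      convolution (φ.normed volume) v (lsmul ℝ ℝ) volume x := by
  have hφc : ContDiff ℝ (⊤ : ℕ∞) (φ.normed (volume : Measure (Rd d))) := φ.contDiff_normed
  have hder := φ.hasCompactSupport_normed.hasFDerivAt_convolution_left (lsmul ℝ ℝ)
    (hφc.of_le (by exact_mod_cast le_top)) hwi x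
  -- The reflected kernel centred at `x` is an admissible test function exactly because its support
  -- lies in the closed ball contained in `Ω`.
  set ψ : Rd d → ℝ := fun y => φ.normed volume (x - y) with hψ
  have hψc : ContDiff ℝ (⊤ : ℕ∞) ψ := hφc.comp (contDiff_const.sub contDiff_id)
  have hψs : tsupport ψ ⊆ Metric.closedBall x φ.rOut := by
    refine closure_minimal (fun y hy => ?_) Metric.isClosed_closedBall
    have : x - y ∈ Function.support (φ.normed (volume : Measure (Rd d))) := hy
    rw [φ.support_normed_eq] at this
    simp only [Metric.mem_ball, dist_zero_right] at this
    rw [Metric.mem_closedBall, dist_comm, dist_eq_norm]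
    exact this.le
  have hψk : HasCompactSupport ψ :=
    (isCompact_closedBall x φ.rOut).of_isClosed_subset (isClosed_tsupport _) hψs
  have hψd : ∀ y, partialDeriv i ψ y =
      -(fderiv ℝ (φ.normed volume) (x - y) (EuclideanSpace.single i 1)) := by
    intro y
    have h1 : HasFDerivAt ψ ((fderiv ℝ (φ.normed volume) (x - y)).comp
        (-(ContinuousLinearMap.id ℝ (Rd d)))) y :=
      ((hφc.differentiable (by simp) (x - y)).hasFDerivAt).comp y
        ((hasFDerivAt_id y).const_sub x)
    rw [partialDeriv, h1.fderiv]
    simp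
  have key := hug ψ hψc hψk (hψs.trans hx)
  rw [partialDeriv, hder.fderiv]
  have hint : Integrable (fun t => (lsmul ℝ ℝ : ℝ →L[ℝ] Cn n →L[ℝ] Cn n).precompL (Rd d)
      (fderiv ℝ (φ.normed volume) t) (w (x - t))) := by
    have := (φ.hasCompactSupport_normed (μ := volume)).fderiv (𝕜 := ℝ) |>.convolutionExists_left
      ((lsmul ℝ ℝ : ℝ →L[ℝ] Cn n →L[ℝ] Cn n).precompL (Rd d))
      (hφc.continuous_fderiv (by simp)) hwi x
    exact this
  have hset : ∀ F : Rd d → Cn n, (∀ y ∉ Ω, F y = 0) → ∫ y, F y = ∫ y in Ω, F y := fun F hF =>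
    (setIntegral_eq_integral_of_forall_compl_eq_zero fun y hy => hF y hy).symm
  calc (convolution (fderiv ℝ (φ.normed volume)) w ((lsmul ℝ ℝ).precompL (Rd d)) volume x)
        (EuclideanSpace.single i 1)
      = ∫ t, (fderiv ℝ (φ.normed volume) t (EuclideanSpace.single i 1)) • w (x - t) := by
        rw [convolution, integral_apply hint]
        rfl
    _ = ∫ y, (fderiv ℝ (φ.normed volume) (x - y) (EuclideanSpace.single i 1)) • w y := by
        rw [← integral_sub_left_eq_self _ volume x]
        simp
    _ = ∫ y in Ω, (fderiv ℝ (φ.normed volume) (x - y) (EuclideanSpace.single i 1)) • w y :=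
        hset _ fun y hy => by simp [hw0 y hy]
    _ = - ∫ y in Ω, partialDeriv i ψ y • u y := by
        rw [← integral_neg]
        refine integral_congr_ae ?_
        filter_upwards [hw] with y hy
        rw [hψd, hy, neg_smul, neg_neg]
    _ = ∫ y in Ω, ψ y • g y := by rw [key, neg_neg]
    _ = ∫ y in Ω, ψ y • v y := by
        refine integral_congr_ae ?_
        filter_upwards [hv] with y hy
        rw [hy]
    _ = ∫ y, φ.normed volume (x - y) • v y := (hset _ fun y hy => by simp [hv0 y hy]).symm
    _ = convolution (φ.normed volume) v (lsmul ℝ ℝ) volume x := by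
        rw [convolution, ← integral_sub_left_eq_self _ volume x]
        simp

/-- Interior smooth approximation of a Sobolev function. -/
theorem SobolevFun.exists_smooth_approx (hΩ : IsOpen Ω) (u : SobolevFun Ω n) :
    ∃ w : ℕ → Rd d → Cn n, (∀ k : ℕ, ContDiff ℝ 1 (w k)) ∧
      (∀ᵐ x ∂(volume.restrict Ω), Tendsto (fun k => w k x) atTop (𝓝 (u.toFun x))) ∧
      (∀ k, ∫⁻ x, ‖w k x‖ₑ ^ 2 ≤ ∫⁻ x in Ω, ‖u.toFun x‖ₑ ^ 2) ∧
      ∀ (k : ℕ) i (D : Set (Rd d)), MeasurableSet D →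
        (∀ x ∈ D, Metric.closedBall x (1 / ((k : ℝ) + 1)) ⊆ Ω) →
        ∫⁻ x in D, ‖partialDeriv i (w k) x‖ₑ ^ 2 ≤ ∫⁻ x in Ω, ‖u.grad i x‖ₑ ^ 2 := by
  obtain ⟨a, ham, hau, ha0, haL, haI⟩ :=
    exists_stronglyMeasurable_extension hΩ.measurableSet u.memLp
  choose b hbm hbu hb0 hbL hbI using fun i =>
    exists_stronglyMeasurable_extension hΩ.measurableSet (u.memLp_grad i)
  have hai : LocallyIntegrable a := haL.locallyIntegrable (by norm_num)
  -- Radii shrink to zero with fixed ratio 2, which is what almost everywhere convergence at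
  -- Lebesgue points requires.
  let φ : ℕ → ContDiffBump (0 : Rd d) := fun k =>
    ⟨1 / ((k : ℝ) + 1) / 2, 1 / ((k : ℝ) + 1), by positivity, half_lt_self (by positivity)⟩
  refine ⟨fun k => convolution ((φ k).normed volume) a (ContinuousLinearMap.lsmul ℝ ℝ) volume,
    fun k => ?_, ?_, fun k => ?_, fun k i D hD hDΩ => ?_⟩
  · exact (φ k).hasCompactSupport_normed.contDiff_convolution_left (n := 1) _
      (φ k).contDiff_normed hai
  · have h := ContDiffBump.ae_convolution_tendsto_right_of_locallyIntegrable (φ := φ)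
      (l := atTop) (K := 2) (g := a) (μ := volume) tendsto_one_div_add_atTop_nhds_zero_nat
      (Eventually.of_forall fun k => by simp only [φ]; linarith) hai
    filter_upwards [ae_restrict_of_ae h, hau] with x hx hxa
    rwa [hxa] at hx
  · rw [← haI]
    exact lintegral_enorm_sq_mollify_le (φ k) ham
  · rw [← hbI i]
    refine le_trans ?_ (lintegral_enorm_sq_mollify_le (φ k) (hbm i))
    refine le_trans (setLIntegral_mono' hD fun x hx => le_of_eq ?_) (setLIntegral_le_lintegral D _)
    rw [partialDeriv_mollify (φ k) (u.weakDeriv i) hau ha0 hai (hbu i) (hb0 i)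
      (hDΩ x hx)]

end Mollification

/-! ### Shift estimates in the interior. -/

section Translation

variable {d n : ℕ} {Ω : Set (Rd d)}

/-- The square of the length of the gradient. -/
noncomputable def gradSq (w : Rd d → Cn n) (x : Rd d) : ℝ≥0∞ := ∑ i, ‖partialDeriv i w x‖ₑ ^ 2

theorem continuous_partialDeriv {w : Rd d → Cn n} (hw : ContDiff ℝ 1 w) (i : Fin d) :
    Continuous (partialDeriv i w) :=
  (hw.continuous_fderiv (by simp)).clm_apply continuous_const

theorem continuous_gradSq {w : Rd d → Cn n} (hw : ContDiff ℝ 1 w) : Continuous (gradSq w) := by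
  have := continuous_partialDeriv hw
  unfold gradSq
  fun_prop

theorem enorm_fderiv_apply_sq_le (w : Rd d → Cn n) (x e : Rd d) :
    ‖fderiv ℝ w x e‖ₑ ^ 2 ≤ ‖e‖ₑ ^ 2 * gradSq w x := by
  have h1 : fderiv ℝ w x e = ∑ i, e i • partialDeriv i w x := by
    conv_lhs => rw [← (EuclideanSpace.basisFun (Fin d) ℝ).sum_repr e]
    simp [map_sum, partialDeriv]
  have h2 : ‖fderiv ℝ w x e‖ ^ 2 ≤ ‖e‖ ^ 2 * ∑ i, ‖partialDeriv i w x‖ ^ 2 := by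
    rw [h1, EuclideanSpace.norm_sq_eq e]
    refine le_trans ?_ (Finset.sum_mul_sq_le_sq_mul_sq Finset.univ (fun i => ‖e i‖)
      fun i => ‖partialDeriv i w x‖)
    refine pow_le_pow_left₀ (norm_nonneg _) ?_ 2
    refine (norm_sum_le _ _).trans_eq ?_
    simp [norm_smul]
  rw [gradSq, ← ofReal_norm, ← ofReal_norm, ← ENNReal.ofReal_pow (norm_nonneg _),
    ← ENNReal.ofReal_pow (norm_nonneg _)]
  have h3 : ∑ i, ‖partialDeriv i w x‖ₑ ^ 2 =
      ENNReal.ofReal (∑ i, ‖partialDeriv i w x‖ ^ 2) := by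
    rw [ENNReal.ofReal_sum_of_nonneg fun i _ => by positivity]
    simp [ENNReal.ofReal_pow]
  rw [h3, ← ENNReal.ofReal_mul (by positivity)]
  exact ENNReal.ofReal_le_ofReal h2

/-- The increment of a smooth function along a segment is controlled by its gradient. -/
theorem enorm_sub_sq_le_lintegral_gradSq {w : Rd d → Cn n} (hw : ContDiff ℝ 1 w) (x e : Rd d)
    {θ : ℝ} (hθ : 0 ≤ θ) :
    ‖w (x + θ • e) - w x‖ₑ ^ 2 ≤
      ENNReal.ofReal θ * ‖e‖ₑ ^ 2 * ∫⁻ η in Ioc 0 θ, gradSq w (x + η • e) := by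
  have hcont : Continuous fun η : ℝ => fderiv ℝ w (x + η • e) e :=
    ((hw.continuous_fderiv (by simp)).comp (by fun_prop)).clm_apply continuous_const
  have hder : ∀ η : ℝ, HasDerivAt (fun η : ℝ => w (x + η • e)) (fderiv ℝ w (x + η • e) e) η := by
    intro η
    have h1 : HasDerivAt (fun η : ℝ => x + η • e) e η := by
      simpa using ((hasDerivAt_id η).smul_const e).const_add x
    exact ((hw.differentiable (by simp) _).hasFDerivAt).comp_hasDerivAt η h1
  have hftc := intervalIntegral.integral_eq_sub_of_hasDerivAt (a := 0) (b := θ)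
    (fun η _ => hder η) (hcont.intervalIntegrable _ _)
  simp only [zero_smul, add_zero] at hftc
  have hle : ‖w (x + θ • e) - w x‖ₑ ≤ ∫⁻ η in Ioc 0 θ, 1 * ‖fderiv ℝ w (x + η • e) e‖ₑ := by
    rw [← hftc, intervalIntegral.integral_of_le hθ]
    simpa using enorm_integral_le_lintegral_enorm _
  have h2 := lintegral_mul_sq_le (μ := volume.restrict (Ioc 0 θ)) (f := fun _ : ℝ => 1)
    (g := fun η => ‖fderiv ℝ w (x + η • e) e‖ₑ) (by fun_prop) (by fun_prop)
  calc ‖w (x + θ • e) - w x‖ₑ ^ 2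
      ≤ (∫⁻ η in Ioc 0 θ, 1 * ‖fderiv ℝ w (x + η • e) e‖ₑ) ^ 2 := by gcongr
    _ ≤ _ := h2
    _ ≤ ENNReal.ofReal θ * ∫⁻ η in Ioc 0 θ, ‖e‖ₑ ^ 2 * gradSq w (x + η • e) := by
        gcongr with η
        · simp
        · exact enorm_fderiv_apply_sq_le w _ e
    _ = _ := by
        rw [lintegral_const_mul, mul_assoc]
        exact ((continuous_gradSq hw).comp (by fun_prop)).measurable

/-- The part of `Ω` at distance at least `t` from its complement. -/
def innerPart (Ω : Set (Rd d)) (t : ℝ) : Set (Rd d) := (Metric.thickening t Ωᶜ)ᶜ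

theorem isClosed_innerPart (Ω : Set (Rd d)) (t : ℝ) : IsClosed (innerPart Ω t) :=
  Metric.isOpen_thickening.isClosed_compl

theorem measurableSet_innerPart (Ω : Set (Rd d)) (t : ℝ) : MeasurableSet (innerPart Ω t) :=
  (isClosed_innerPart Ω t).measurableSet

theorem mem_innerPart_iff {t : ℝ} {x : Rd d} :
    x ∈ innerPart Ω t ↔ Metric.ball x t ⊆ Ω := by
  rw [innerPart, mem_compl_iff, Metric.mem_thickening_iff]
  constructor
  · intro h y hy
    by_contra hyΩ
    exact h ⟨y, hyΩ, by rwa [dist_comm]⟩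
  · rintro h ⟨y, hyΩ, hy⟩
    exact hyΩ (h (by rwa [Metric.mem_ball, dist_comm]))

theorem innerPart_subset {t : ℝ} (ht : 0 < t) : innerPart Ω t ⊆ Ω := fun _ hx =>
  mem_innerPart_iff.1 hx (Metric.mem_ball_self ht)

theorem innerPart_anti {s t : ℝ} (h : s ≤ t) : innerPart Ω t ⊆ innerPart Ω s := fun _ hx =>
  mem_innerPart_iff.2 ((Metric.ball_subset_ball h).trans (mem_innerPart_iff.1 hx))

theorem add_mem_innerPart {s t : ℝ} {x h : Rd d} (hx : x ∈ innerPart Ω t) (hh : s + ‖h‖ ≤ t) :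
    x + h ∈ innerPart Ω s := by
  rw [mem_innerPart_iff] at hx ⊢
  refine (Metric.ball_subset_ball' ?_).trans hx
  simpa using hh

/-- The gradient bound holds only eventually in `k`: the mollification radius `1 / (k + 1)` must
first fall below `s`, so that the mollified function has the mollified weak gradient throughout
`innerPart Ω s`. -/
theorem SobolevFun.exists_smooth_approx_gradSq (hΩ : IsOpen Ω) (u : SobolevFun Ω n) :
    ∃ w : ℕ → Rd d → Cn n, (∀ k : ℕ, ContDiff ℝ 1 (w k)) ∧
      (∀ᵐ x ∂(volume.restrict Ω), Tendsto (fun k => w k x) atTop (𝓝 (u.toFun x))) ∧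
      (∀ k, ∫⁻ x, ‖w k x‖ₑ ^ 2 ≤ ENNReal.ofReal (u.sobolevNorm ^ 2)) ∧
      ∀ s > 0, ∀ᶠ k in atTop,
        ∫⁻ x in innerPart Ω s, gradSq (w k) x ≤ ENNReal.ofReal (u.sobolevNorm ^ 2) := by
  obtain ⟨w, hw, hlim, hL, hG⟩ := u.exists_smooth_approx hΩ
  refine ⟨w, hw, hlim, fun k => (hL k).trans u.lintegral_toFun_le, fun s hs => ?_⟩
  filter_upwards [tendsto_one_div_add_atTop_nhds_zero_nat.eventually_lt_const hs] with k hk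
  refine le_trans ?_ u.lintegral_grad_le
  unfold gradSq
  rw [lintegral_finsetSum _ fun i _ => by
    have := continuous_partialDeriv (hw k) i
    fun_prop]
  refine Finset.sum_le_sum fun i _ => hG k i _ (measurableSet_innerPart Ω s) fun x hx => ?_
  exact (Metric.closedBall_subset_ball hk).trans (mem_innerPart_iff.1 hx)

theorem setLIntegral_comp_add_right_le {A B : Set (Rd d)} (hA : MeasurableSet A)
    (hB : MeasurableSet B) {h : Rd d} (hAB : ∀ x ∈ A, x + h ∈ B) (F : Rd d → ℝ≥0∞) :
    ∫⁻ x in A, F (x + h) ≤ ∫⁻ x in B, F x := by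
  rw [← lintegral_indicator hA, ← lintegral_indicator hB,
    ← lintegral_add_right_eq_self (B.indicator F) h]
  refine lintegral_mono fun x => ?_
  by_cases hx : x ∈ A
  · simp [hx, hAB x hx]
  · simp [hx]

/-- The translation estimate in the interior for a Sobolev function. -/
theorem SobolevFun.lintegral_translate_sub_le (hΩ : IsOpen Ω) (u : SobolevFun Ω n) {t : ℝ}
    {h : Rd d} (ht : 0 < t) (hh : ‖h‖ ≤ t / 2) :
    ∫⁻ x in innerPart Ω t, ‖u.toFun (x + h) - u.toFun x‖ₑ ^ 2 ≤
      ENNReal.ofReal ((‖h‖ * u.sobolevNorm) ^ 2) := by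
  obtain ⟨w, hw, hlim, hL, hG⟩ := u.exists_smooth_approx_gradSq hΩ
  have hDm := measurableSet_innerPart Ω t
  have hmeas : ∀ k, Measurable fun x => ‖w k (x + h) - w k x‖ₑ ^ 2 := fun k => by
    have := (hw k).continuous
    fun_prop
  have hlim' : ∀ᵐ x ∂(volume : Measure (Rd d)), x ∈ Ω →
      Tendsto (fun k => w k x) atTop (𝓝 (u.toFun x)) :=
    (ae_restrict_iff' hΩ.measurableSet).1 hlim
  have hlimh : ∀ᵐ x ∂(volume : Measure (Rd d)), x + h ∈ Ω →
      Tendsto (fun k => w k (x + h)) atTop (𝓝 (u.toFun (x + h))) :=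
    (measurePreserving_add_right volume h).quasiMeasurePreserving.ae hlim'
  have hbound : ∀ᶠ k in atTop, ∫⁻ x in innerPart Ω t, ‖w k (x + h) - w k x‖ₑ ^ 2 ≤
      ENNReal.ofReal ((‖h‖ * u.sobolevNorm) ^ 2) := by
    -- Since `‖h‖ ≤ t / 2`, the segments from points of `innerPart Ω t` to their shifts stay in
    -- `innerPart Ω (t / 2)`, where the gradient is controlled.
    filter_upwards [hG (t / 2) (by positivity)] with k hk
    have hgc := continuous_gradSq (hw k)
    calc ∫⁻ x in innerPart Ω t, ‖w k (x + h) - w k x‖ₑ ^ 2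
        ≤ ∫⁻ x in innerPart Ω t, ‖h‖ₑ ^ 2 * ∫⁻ η in Ioc (0 : ℝ) 1, gradSq (w k) (x + η • h) := by
          refine lintegral_mono fun x => ?_
          simpa using enorm_sub_sq_le_lintegral_gradSq (hw k) x h zero_le_one
      _ = ‖h‖ₑ ^ 2 * ∫⁻ x in innerPart Ω t, ∫⁻ η in Ioc (0 : ℝ) 1, gradSq (w k) (x + η • h) := by
          refine lintegral_const_mul' _ _ (by simp)
      _ = ‖h‖ₑ ^ 2 * ∫⁻ η in Ioc (0 : ℝ) 1, ∫⁻ x in innerPart Ω t, gradSq (w k) (x + η • h) := by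
          rw [lintegral_lintegral_swap]
          unfold Function.uncurry
          exact (hgc.comp (by fun_prop)).measurable.aemeasurable
      _ ≤ ‖h‖ₑ ^ 2 * ∫⁻ η in Ioc (0 : ℝ) 1, ENNReal.ofReal (u.sobolevNorm ^ 2) := by
          refine mul_le_mul' le_rfl (setLIntegral_mono' measurableSet_Ioc fun η hη => ?_)
          refine le_trans ?_ hk
          refine setLIntegral_comp_add_right_le hDm (measurableSet_innerPart Ω _)
            (fun x hx => ?_) _
          refine add_mem_innerPart hx ?_
          rw [norm_smul, Real.norm_of_nonneg hη.1.le]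
          nlinarith [hη.2, norm_nonneg h]
      _ = ENNReal.ofReal ((‖h‖ * u.sobolevNorm) ^ 2) := by
          rw [mul_pow, ENNReal.ofReal_mul (by positivity), ENNReal.ofReal_pow (norm_nonneg _),
            ofReal_norm]
          simp
  -- Fatou's lemma transfers the uniform bound to the almost everywhere limit.
  calc ∫⁻ x in innerPart Ω t, ‖u.toFun (x + h) - u.toFun x‖ₑ ^ 2
      ≤ ∫⁻ x in innerPart Ω t, liminf (fun k => ‖w k (x + h) - w k x‖ₑ ^ 2) atTop := by
        refine lintegral_mono_ae ?_
        filter_upwards [ae_restrict_of_ae hlim', ae_restrict_of_ae hlimh,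
          ae_restrict_mem hDm] with x hx hxh hxD
        have h1 := hx (innerPart_subset ht hxD)
        have h2 := hxh (innerPart_subset (by positivity : 0 < t / 2)
          (add_mem_innerPart hxD (by linarith)))
        have h3 := ((ENNReal.continuous_pow 2).tendsto _).comp (h2.sub h1).enorm
        exact h3.liminf_eq.ge
    _ ≤ liminf (fun k => ∫⁻ x in innerPart Ω t, ‖w k (x + h) - w k x‖ₑ ^ 2) atTop :=
        lintegral_liminf_le hmeas
    _ ≤ _ := (liminf_le_liminf hbound).trans_eq (by simp)

end Translation

/-! ### Nearest boundary points and inward normals. -/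

section NearestPoint

variable {d : ℕ} {Ω : Set (Rd d)}

/-- A nearest point of the complement lies on the frontier, and the frontier of an open set lies in
the complement. -/
theorem infDist_frontier_eq (hΩ : IsOpen Ω) {x : Rd d} (hx : x ∈ Ω) (hne : Ω ≠ univ) :
    Metric.infDist x (frontier Ω) = Metric.infDist x Ωᶜ := by
  obtain ⟨q, hq, hqd⟩ := exists_mem_frontier_infDist_compl_eq_dist hx hne
  refine le_antisymm (hqd ▸ Metric.infDist_le_dist_of_mem hq) ?_
  refine Metric.infDist_le_infDist_of_subset (fun y hy hyΩ => ?_) ⟨q, hq⟩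
  exact (hΩ.inter_frontier_eq ▸ (⟨hyΩ, hy⟩ : y ∈ Ω ∩ frontier Ω) : y ∈ (∅ : Set (Rd d)))

theorem mem_innerPart_iff_le_infDist (hne : Ω ≠ univ) {x : Rd d} {t : ℝ} :
    x ∈ innerPart Ω t ↔ t ≤ Metric.infDist x Ωᶜ := by
  rw [mem_innerPart_iff]
  constructor
  · intro h
    refine (Metric.le_infDist (nonempty_compl.2 hne)).2 fun y hy => ?_
    by_contra! hlt
    exact hy (h (by rwa [Metric.mem_ball, dist_comm]))
  · exact fun h => (Metric.ball_subset_ball h).trans Metric.ball_infDist_compl_subset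

/-- A negative value at `p` would keep `Ω` away from `p`; a positive one would put `p` inside the
open set `Ω`. -/
theorem IsDefiningFunction.eq_zero {p : Rd d} {U : Set (Rd d)} {f : Rd d → ℝ} (hΩ : IsOpen Ω)
    (hf : IsDefiningFunction Ω p U f) (hp : p ∈ frontier Ω) : f p = 0 := by
  obtain ⟨hU, hpU, hfC, -, hΩU⟩ := hf
  have hfc : ContinuousAt f p := (hfC.continuousOn).continuousAt (hU.mem_nhds hpU)
  rcases lt_trichotomy (f p) 0 with h | h | h
  · have h1 : ∀ᶠ y in 𝓝 p, f y < 0 ∧ y ∈ U :=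
      (hfc.eventually_lt_const h).and (hU.mem_nhds hpU)
    obtain ⟨y, ⟨hy, hyU⟩, hyΩ⟩ := mem_closure_iff_nhds.1 hp.1 _ h1
    have : y ∈ {x | x ∈ U ∧ 0 < f x} := hΩU ▸ ⟨hyΩ, hyU⟩
    exact absurd this.2 (not_lt.2 hy.le)
  · exact h
  · have : p ∈ Ω ∩ U := hΩU ▸ ⟨hpU, h⟩
    rw [hΩ.frontier_eq] at hp
    exact absurd this.1 hp.2

/-- If `x` sees the boundary point `q` along a ball contained in `Ω`, then `x` lies on the inward
normal at `q`. -/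
theorem IsInwardNormal.eq_add_smul {q ν x : Rd d} (hΩ : IsOpen Ω) (hq : q ∈ frontier Ω)
    (hν : IsInwardNormal Ω q ν) (hx : x ∈ Ω) (hball : Metric.ball x (dist x q) ⊆ Ω) :
    x = q + dist x q • ν := by
  obtain ⟨U, f, hf, rfl⟩ := hν
  have hf0 := hf.eq_zero hΩ hq
  obtain ⟨hU, hqU, hfC, hgrad, hΩU⟩ := hf
  set g := gradient f q with hg
  set e := x - q with he
  have hxq : x ≠ q := by
    rintro rfl
    rw [hΩ.frontier_eq] at hq
    exact hq.2 hx
  have he0 : e ≠ 0 := sub_ne_zero.2 hxq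
  have hep : 0 < ‖e‖ := norm_pos_iff.2 he0
  have hg0 : g ≠ 0 := hgrad q hqU
  have hgp : 0 < ‖g‖ := norm_pos_iff.2 hg0
  have hder : HasGradientAt f g q :=
    ((hfC.contDiffAt (hU.mem_nhds hqU)).differentiableAt (by simp)).hasGradientAt
  -- A direction `w` with positive component along `e` enters the ball, hence `Ω`, where `f > 0`. As
  -- `f q = 0`, the one-sided derivative of `f` along `w` is nonnegative.
  have hdir : ∀ w : Rd d, 0 < inner ℝ e w → 0 ≤ inner ℝ g w := by
    intro w hw
    have hline : HasDerivAt (fun s : ℝ => q + s • w) w 0 := by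
      simpa using ((hasDerivAt_id (0 : ℝ)).smul_const w).const_add q
    have hd : HasDerivAt (fun s : ℝ => f (q + s • w)) (inner ℝ g w) 0 := by
      have h1 : HasFDerivAt f (InnerProductSpace.toDual ℝ (Rd d) g) (q + (0 : ℝ) • w) := by
        simpa using hder.hasFDerivAt
      have h2 := h1.comp_hasDerivAt (0 : ℝ) hline
      rw [InnerProductSpace.toDual_apply_apply] at h2
      exact h2
    have hUs : ∀ᶠ s : ℝ in 𝓝[>] 0, q + s • w ∈ U := by
      refine (hline.continuousAt.eventually ?_).filter_mono nhdsWithin_le_nhds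
      simpa using hU.mem_nhds hqU
    have hsmall : ∀ᶠ s : ℝ in 𝓝[>] 0, s * ‖w‖ ^ 2 < 2 * inner ℝ e w := by
      have : ContinuousAt (fun s : ℝ => s * ‖w‖ ^ 2) 0 := by fun_prop
      refine (this.eventually_lt_const ?_).filter_mono nhdsWithin_le_nhds
      simpa using hw
    have hpos : ∀ᶠ s : ℝ in 𝓝[>] 0, 0 ≤ slope (fun s : ℝ => f (q + s • w)) 0 s := by
      filter_upwards [hUs, hsmall, self_mem_nhdsWithin] with s hsU hs hs0
      have hs0 : 0 < s := hs0
      have hmem : q + s • w ∈ Ω := by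
        refine hball ?_
        rw [Metric.mem_ball, dist_comm, dist_eq_norm, dist_eq_norm, ← he,
          show x - (q + s • w) = e - s • w by rw [he]; abel]
        refine lt_of_pow_lt_pow_left₀ 2 hep.le ?_
        rw [norm_sub_sq_real, inner_smul_right, norm_smul, Real.norm_of_nonneg hs0.le]
        nlinarith
      have : q + s • w ∈ {x | x ∈ U ∧ 0 < f x} := hΩU ▸ ⟨hmem, hsU⟩
      rw [slope_def_field]
      simp only [zero_smul, add_zero, hf0, sub_zero]
      exact (div_pos this.2 hs0).le
    exact ge_of_tendsto ((hasDerivWithinAt_iff_tendsto_slope' (by simp)).1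
      (hd.hasDerivWithinAt (s := Ioi 0))) hpos
  -- The closed half-space follows by tilting `w` towards `e` and letting the tilt vanish.
  have hdir' : ∀ w : Rd d, 0 ≤ inner ℝ e w → 0 ≤ inner ℝ g w := by
    intro w hw
    have hlim : Tendsto (fun s : ℝ => inner ℝ g (w + s • e)) (𝓝[>] 0) (𝓝 (inner ℝ g w)) := by
      have : ContinuousAt (fun s : ℝ => inner ℝ g (w + s • e)) 0 := by fun_prop
      simpa [ContinuousAt] using this.tendsto.mono_left nhdsWithin_le_nhds
    refine ge_of_tendsto hlim ?_
    filter_upwards [self_mem_nhdsWithin] with s hs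
    refine hdir _ ?_
    rw [inner_add_right, inner_smul_right, real_inner_self_eq_norm_sq]
    have : 0 < s := hs
    positivity
  -- Here `a • e` is the projection of `g` onto `e`. The vector `a • e - g` is orthogonal to `e`, so
  -- `hdir'` applies to it and gives `‖a • e - g‖ ^ 2 ≤ 0`: the gradient is parallel to `e`.
  set a := inner ℝ g e / ‖e‖ ^ 2 with ha
  have ha' : a * ‖e‖ ^ 2 = inner ℝ g e := by
    rw [ha]; field_simp
  have hortho : inner ℝ e (a • e - g) = 0 := by
    rw [inner_sub_right, inner_smul_right, real_inner_self_eq_norm_sq, ha', real_inner_comm, sub_self]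
  have hga : g = a • e := by
    have h1 : 0 ≤ inner ℝ g (a • e - g) := hdir' _ hortho.ge
    have h2 : ‖a • e - g‖ ^ 2 ≤ 0 := by
      rw [← real_inner_self_eq_norm_sq]
      conv_lhs => rw [inner_sub_left, inner_smul_left]
      rw [hortho]
      simpa using h1
    have h3 : a • e - g = 0 := by
      rw [← norm_eq_zero]
      exact pow_eq_zero_iff two_ne_zero |>.1 (le_antisymm h2 (sq_nonneg _))
    exact (sub_eq_zero.1 h3).symm
  have ha0 : 0 < a := by
    have h1 : 0 ≤ inner ℝ g e := hdir' e (by rw [real_inner_self_eq_norm_sq]; positivity)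
    have h2 : 0 ≤ a := by rw [ha]; positivity
    refine lt_of_le_of_ne h2 fun h => hg0 ?_
    rw [hga, ← h, zero_smul]
  have hnorm : ‖g‖ = a * ‖e‖ := by rw [hga, norm_smul, Real.norm_of_nonneg ha0.le]
  have : dist x q • (‖g‖⁻¹ • g) = e := by
    rw [dist_eq_norm, ← he, hnorm, hga, smul_smul, smul_smul]
    have : ‖e‖ * (a * ‖e‖)⁻¹ * a = 1 := by field_simp
    rw [this, one_smul]
  rw [this, he]
  abel

theorem IsInwardNormal.norm_eq_one {q ν : Rd d} (hν : IsInwardNormal Ω q ν) : ‖ν‖ = 1 := by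
  obtain ⟨U, f, hf, rfl⟩ := hν
  have : ‖gradient f q‖ ≠ 0 := norm_ne_zero_iff.2 (hf.2.2.2.1 q hf.2.1)
  rw [norm_smul, norm_inv, norm_norm, inv_mul_cancel₀ this]

/-- Every point of the boundary layer lies on an inward normal, at a height equal to its distance
to the complement. -/
theorem exists_eq_add_infDist_smul {ν : Rd d → Rd d} (hΩ : IsOpen Ω) (hne : Ω ≠ univ)
    (hν : ∀ p ∈ frontier Ω, IsInwardNormal Ω p (ν p)) {x : Rd d} (hx : x ∈ Ω) :
    0 < Metric.infDist x Ωᶜ ∧ ∃ q ∈ frontier Ω, x = q + Metric.infDist x Ωᶜ • ν q := by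
  obtain ⟨q, hq, hqd⟩ := exists_mem_frontier_infDist_compl_eq_dist hx hne
  constructor
  · exact (hΩ.isClosed_compl.notMem_iff_infDist_pos (nonempty_compl.2 hne)).1 (not_not.2 hx)
  · refine ⟨q, hq, ?_⟩
    have := (hν q hq).eq_add_smul hΩ hq hx (by
      rw [← hqd]; exact Metric.ball_infDist_compl_subset)
    rwa [← hqd] at this

/-- The point also lies on the normal at one of its nearest boundary points, at a height equal to
its distance. Injectivity of the normal coordinates identifies the two representations. Consequently
moving inward by `θ` raises the distance by exactly `θ` as long as the height stays within `τ₀`. -/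
theorem infDist_add_smul_normal {ν : Rd d → Rd d} {τ₀ : ℝ} (hΩ : IsOpen Ω) (hne : Ω ≠ univ)
    (hν : ∀ p ∈ frontier Ω, IsInwardNormal Ω p (ν p))
    (hbij : BijOn (fun q : Rd d × ℝ => q.1 + q.2 • ν q.1) (frontier Ω ×ˢ Ioc 0 τ₀)
      (boundaryLayer Ω τ₀)) {p : Rd d} (hp : p ∈ frontier Ω) {τ : ℝ} (hτ : τ ∈ Ioc 0 τ₀) :
    Metric.infDist (p + τ • ν p) Ωᶜ = τ := by
  have hmem : p + τ • ν p ∈ boundaryLayer Ω τ₀ := hbij.mapsTo (mk_mem_prod hp hτ)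
  obtain ⟨hpos, q, hq, hqe⟩ := exists_eq_add_infDist_smul hΩ hne hν hmem.1
  have hle := hmem.2
  rw [infDist_frontier_eq hΩ hmem.1 hne] at hle
  have := hbij.injOn (mk_mem_prod hp hτ) (mk_mem_prod hq ⟨hpos, hle⟩) hqe
  exact (congrArg Prod.snd this).symm

end NearestPoint

/-! ### Change of variables to normal coordinates. -/

section Charts

variable {d : ℕ} [NeZero d]

/-- The points `y = (τ, s)` with `s ∈ S` and `0 < τ ≤ t`. -/
def chartCylinder (S : Set (TangentialSpace d)) (t : ℝ) : Set (Rd d) :=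
  {y | tangentialPart y ∈ S ∧ y 0 ∈ Ioc 0 t}

theorem continuous_tangentialPart : Continuous (tangentialPart : Rd d → TangentialSpace d) := by
  unfold tangentialPart
  fun_prop

theorem measurableSet_chartCylinder {S : Set (TangentialSpace d)} (hS : MeasurableSet S) (t : ℝ) :
    MeasurableSet (chartCylinder S t) := by
  have h1 : Measurable (tangentialPart : Rd d → TangentialSpace d) :=
    continuous_tangentialPart.measurable
  have h2 : Measurable fun y : Rd d => y 0 := by fun_prop
  exact (h1 hS).inter (h2 measurableSet_Ioc)

theorem chartCylinder_mono {S : Set (TangentialSpace d)} {s t : ℝ} (h : s ≤ t) :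
    chartCylinder S s ⊆ chartCylinder S t := fun _ hy => ⟨hy.1, hy.2.1, hy.2.2.trans h⟩

theorem tangentialPart_add_smul (y : Rd d) (θ : ℝ) :
    tangentialPart (y + θ • EuclideanSpace.single 0 1) = tangentialPart y := by
  ext i
  simp [tangentialPart, i.2]

theorem normalCoordinateMap_add_smul (ν : Rd d → Rd d) (φ : TangentialSpace d → Rd d) (y : Rd d)
    (θ : ℝ) :
    normalCoordinateMap ν φ (y + θ • EuclideanSpace.single 0 1) =
      φ (tangentialPart y) + (y 0 + θ) • ν (φ (tangentialPart y)) := by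
  simp [normalCoordinateMap, tangentialPart_add_smul]

theorem add_smul_mem_chartCylinder {S : Set (TangentialSpace d)} {t a b θ : ℝ} {y : Rd d}
    (hy : y ∈ chartCylinder S t) (hθ : θ ∈ Ioc 0 a) (h : t + a ≤ b) :
    y + θ • EuclideanSpace.single 0 1 ∈ chartCylinder S b := by
  refine ⟨by rw [tangentialPart_add_smul]; exact hy.1, ?_, ?_⟩
  · simpa using add_pos hy.2.1 hθ.1
  · have h1 := hy.2.2
    have h2 := hθ.2
    simp
    linarith

/-- Where a map is not differentiable, `fderiv` is zero by convention, and its determinant vanishes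
since `d ≥ 1`. The lower Jacobian bound therefore already contains differentiability. -/
theorem hasFDerivAt_of_det_ne_zero {Ψ : Rd d → Rd d} {y : Rd d} (h : (fderiv ℝ Ψ y).det ≠ 0) :
    HasFDerivAt Ψ (fderiv ℝ Ψ y) y := by
  refine DifferentiableAt.hasFDerivAt ?_
  by_contra hnd
  rw [fderiv_zero_of_not_differentiableAt hnd] at h
  refine h ?_
  have : Nontrivial (Rd d) := inferInstance
  rw [ContinuousLinearMap.det, ContinuousLinearMap.toLinearMap_zero, LinearMap.det_zero]
  simp [NeZero.ne d]

/-- The averaging estimate of the boundary layer in a single chart. -/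
theorem lintegral_image_chartCylinder_le {S : Set (TangentialSpace d)} (hS : MeasurableSet S)
    {Ψ : Rd d → Rd d} {c K a t b : ℝ} (hc : 0 < c) (htb : t + a ≤ b) (ha : 0 ≤ a)
    (hinj : InjOn Ψ (chartCylinder S b))
    (hlow : ∀ y ∈ chartCylinder S b, c ≤ |(fderiv ℝ Ψ y).det|)
    (hup : ∀ y ∈ chartCylinder S b, |(fderiv ℝ Ψ y).det| ≤ K)
    {F h : Rd d → ℝ≥0∞} (hh : Measurable h)
    (hF : ∀ y ∈ chartCylinder S t, ENNReal.ofReal a * F (Ψ y) ≤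
      ∫⁻ θ in Ioc 0 a, h (Ψ (y + θ • EuclideanSpace.single 0 1))) :
    ENNReal.ofReal a * (ENNReal.ofReal c * ∫⁻ x in Ψ '' chartCylinder S t, F x) ≤
      ENNReal.ofReal K * ENNReal.ofReal t * ∫⁻ x in Ψ '' chartCylinder S b, h x := by
  set e : Rd d := EuclideanSpace.single 0 1
  set T := chartCylinder S b
  have hTm : MeasurableSet T := measurableSet_chartCylinder hS b
  have hTtm : MeasurableSet (chartCylinder S t) := measurableSet_chartCylinder hS t
  have hsub : chartCylinder S t ⊆ T := chartCylinder_mono (by linarith)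
  have hder : ∀ y ∈ T, HasFDerivAt Ψ (fderiv ℝ Ψ y) y := fun y hy =>
    hasFDerivAt_of_det_ne_zero (abs_pos.1 (hc.trans_le (hlow y hy)))
  have hcont : ContinuousOn Ψ T := fun y hy => (hder y hy).continuousAt.continuousWithinAt
  -- The map `Ψ` is continuous only on `T`; cutting off outside `T` gives a globally measurable
  -- function, as the exchanges of integrals need.
  set H : Rd d → ℝ≥0∞ := T.indicator (fun y => h (Ψ y)) with hH
  have hHm : Measurable H := by
    have h1 : Measurable (T.domRestrict Ψ) := (continuousOn_iff_continuous_domRestrict.1 hcont).measurable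
    refine measurable_of_restrict_of_restrict_compl hTm ?_ ?_
    · have : T.domRestrict H = h ∘ T.domRestrict Ψ := by
        ext ⟨y, hy⟩
        simp [hH, hy]
      rw [this]
      exact hh.comp h1
    · have : Tᶜ.domRestrict H = fun _ => 0 := by
        ext ⟨y, hy⟩
        have : y ∉ T := hy
        simp [hH, this]
      rw [this]
      exact measurable_const
  have step1 : ENNReal.ofReal a * ∫⁻ x in Ψ '' chartCylinder S t, F x ≤
      ENNReal.ofReal K * (ENNReal.ofReal t * ∫⁻ y, H y) := by
    rw [lintegral_image_eq_lintegral_abs_det_fderiv_mul volume hTtm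
      (fun y hy => (hder y (hsub hy)).hasFDerivWithinAt) (hinj.mono hsub),
      ← lintegral_const_mul' _ _ (by simp)]
    calc ∫⁻ y in chartCylinder S t, ENNReal.ofReal a *
          (ENNReal.ofReal |(fderiv ℝ Ψ y).det| * F (Ψ y))
        ≤ ∫⁻ y in chartCylinder S t, ENNReal.ofReal K * ∫⁻ θ in Ioc 0 a, H (y + θ • e) := by
          refine setLIntegral_mono' hTtm fun y hy => ?_
          rw [mul_left_comm]
          refine mul_le_mul' (ENNReal.ofReal_le_ofReal (hup y (hsub hy))) ((hF y hy).trans_eq ?_)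
          refine setLIntegral_congr_fun measurableSet_Ioc fun θ hθ => ?_
          simp only [hH]
          rw [indicator_of_mem (add_smul_mem_chartCylinder hy hθ htb)]
      _ = ENNReal.ofReal K * ∫⁻ y in chartCylinder S t, ∫⁻ θ in Ioc 0 a, H (y + θ • e) :=
          lintegral_const_mul' _ _ (by simp)
      _ = ENNReal.ofReal K * ∫⁻ θ in Ioc 0 a, ∫⁻ y in chartCylinder S t, H (y + θ • e) := by
          rw [lintegral_lintegral_swap]
          unfold Function.uncurry
          exact (hHm.comp (by fun_prop)).aemeasurable
      _ = ENNReal.ofReal K * ∫⁻ θ in Ioc 0 a, ∫⁻ y,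
            (chartCylinder S t).indicator 1 (y - θ • e) * H y := by
          congr 1
          refine lintegral_congr fun θ => ?_
          rw [← lintegral_indicator hTtm, ← lintegral_sub_right_eq_self _ (θ • e)]
          refine lintegral_congr fun y => ?_
          by_cases hy : y - θ • e ∈ chartCylinder S t <;> simp [hy]
      _ = ENNReal.ofReal K * ∫⁻ y, ∫⁻ θ in Ioc 0 a,
            (chartCylinder S t).indicator 1 (y - θ • e) * H y := by
          rw [lintegral_lintegral_swap]
          unfold Function.uncurry
          refine (Measurable.mul ?_ (hHm.comp measurable_snd)).aemeasurable
          exact (measurable_one.indicator hTtm).comp (by fun_prop)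
      _ ≤ ENNReal.ofReal K * ∫⁻ y, ENNReal.ofReal t * H y := by
          refine mul_le_mul' le_rfl (lintegral_mono fun y => ?_)
          have hm : Measurable fun θ : ℝ =>
              (chartCylinder S t).indicator (1 : Rd d → ℝ≥0∞) (y - θ • e) :=
            (measurable_one.indicator hTtm).comp (by fun_prop)
          rw [lintegral_mul_const _ hm]
          refine mul_le_mul' ?_ le_rfl
          -- For fixed `y`, the shifts `θ` with `y - θ • e` of height in `(0, t]` fill at most an
          -- interval of length `t`. This is the source of the small factor `t`.
          calc ∫⁻ θ in Ioc 0 a, (chartCylinder S t).indicator (1 : Rd d → ℝ≥0∞) (y - θ • e)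
              ≤ ∫⁻ θ : ℝ, (chartCylinder S t).indicator (1 : Rd d → ℝ≥0∞) (y - θ • e) :=
                setLIntegral_le_lintegral _ _
            _ ≤ ∫⁻ θ : ℝ, (Ico (y 0 - t) (y 0)).indicator 1 θ := by
                refine lintegral_mono fun θ => ?_
                by_cases hy : y - θ • e ∈ chartCylinder S t
                · have h1 := hy.2
                  simp only [e, PiLp.sub_apply, PiLp.smul_apply, PiLp.single_apply,
                    if_true, smul_eq_mul, mul_one, mem_Ioc] at h1
                  have h2 : θ ∈ Ico (y 0 - t) (y 0) := ⟨by linarith, by linarith⟩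
                  simp [hy, h2]
                · simp [hy]
            _ = ENNReal.ofReal t := by
                rw [lintegral_indicator_one measurableSet_Ico, Real.volume_Ico]
                congr 1
                ring
      _ = _ := by rw [lintegral_const_mul _ hHm]
  -- The lower Jacobian bound returns from `(τ, s)` to `x`.
  have step2 : ENNReal.ofReal c * ∫⁻ y, H y ≤ ∫⁻ x in Ψ '' T, h x := by
    rw [lintegral_image_eq_lintegral_abs_det_fderiv_mul volume hTm
      (fun y hy => (hder y hy).hasFDerivWithinAt) hinj, lintegral_indicator hTm,
      ← lintegral_const_mul' _ _ (by simp)]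
    exact setLIntegral_mono' hTm fun y hy =>
      mul_le_mul' (ENNReal.ofReal_le_ofReal (hlow y hy)) le_rfl
  calc ENNReal.ofReal a * (ENNReal.ofReal c * ∫⁻ x in Ψ '' chartCylinder S t, F x)
      = ENNReal.ofReal c * (ENNReal.ofReal a * ∫⁻ x in Ψ '' chartCylinder S t, F x) := by ring
    _ ≤ ENNReal.ofReal c * (ENNReal.ofReal K * (ENNReal.ofReal t * ∫⁻ y, H y)) := by gcongr
    _ = ENNReal.ofReal K * ENNReal.ofReal t * (ENNReal.ofReal c * ∫⁻ y, H y) := by ring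
    _ ≤ _ := by gcongr

theorem measurableSet_inter_preimage_of_continuousOn {X Y : Type*} [TopologicalSpace X]
    [MeasurableSpace X] [OpensMeasurableSpace X] [TopologicalSpace Y] [MeasurableSpace Y]
    [BorelSpace Y] {f : X → Y} {S : Set X} (hS : MeasurableSet S) (hf : ContinuousOn f S)
    {B : Set Y} (hB : MeasurableSet B) : MeasurableSet (S ∩ f ⁻¹' B) := by
  have h1 : Measurable (S.domRestrict f) := (continuousOn_iff_continuous_domRestrict.1 hf).measurable
  have h2 : S ∩ f ⁻¹' B = Subtype.val '' (S.domRestrict f ⁻¹' B) := by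
    ext x
    simp [and_comm]
  rw [h2]
  exact hS.subtype_image (h1 hB)

/-- The averaging estimate of the boundary layer. -/
theorem lintegral_boundaryLayer_le {Ω : Set (Rd d)} (hΩ : IsOpen Ω) (hne : Ω ≠ univ)
    (hnc : HasUniformNormalCoordinates Ω) :
    ∃ (a : ℝ) (ν : Rd d → Rd d) (c K : ℝ), 0 < a ∧ 0 < c ∧
      (∀ p ∈ frontier Ω, ‖ν p‖ = 1) ∧
      (∀ p ∈ frontier Ω, ∀ τ ∈ Ioc 0 (2 * a), Metric.infDist (p + τ • ν p) Ωᶜ = τ) ∧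
      ∀ t ≤ a, ∀ F h : Rd d → ℝ≥0∞, Measurable h →
        (∀ p ∈ frontier Ω, ∀ τ ∈ Ioc 0 t, ENNReal.ofReal a * F (p + τ • ν p) ≤
          ∫⁻ θ in Ioc 0 a, h (p + (τ + θ) • ν p)) →
        ENNReal.ofReal a * (ENNReal.ofReal c * ∫⁻ x in boundaryLayer Ω t, F x) ≤
          ENNReal.ofReal K * ENNReal.ofReal t * ∫⁻ x, h x := by
  obtain ⟨τ₀, ν, hτ₀, hν, hbij, c, K, hc, hchart⟩ := hnc
  have hdist := fun p (hp : p ∈ frontier Ω) τ (hτ : τ ∈ Ioc 0 τ₀) =>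
    infDist_add_smul_normal hΩ hne hν hbij hp hτ
  -- Half of `τ₀`: a starting height at most `a` plus an inward step at most `a` remains in the
  -- layer of width `τ₀`.
  refine ⟨τ₀ / 2, ν, c, K, by positivity, hc, fun p hp => (hν p hp).norm_eq_one, ?_, ?_⟩
  · rw [mul_div_cancel₀ _ two_ne_zero]
    exact hdist
  intro t ht F h hh hF
  by_cases hfr : (frontier Ω).Nonempty
  swap
  · have : boundaryLayer Ω t = ∅ := by
      refine eq_empty_of_forall_notMem fun x hx => hfr ?_
      obtain ⟨-, q, hq, -⟩ := exists_eq_add_infDist_smul hΩ hne hν hx.1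
      exact ⟨q, hq⟩
    simp [this]
  choose! S φ hSo hφC hφi hφm hφn hJ using hchart
  -- By the Lindelöf property countably many charts cover the boundary, even when it is not compact.
  obtain ⟨I, hIsub, hIc, hIcov⟩ := TopologicalSpace.countable_cover_nhdsWithin hφn
  have hIne : I.Nonempty := by
    obtain ⟨p, hp⟩ := hfr
    obtain ⟨q, hq, -⟩ := mem_iUnion₂.1 (hIcov hp)
    exact ⟨q, hq⟩
  obtain ⟨f, rfl⟩ := hIc.exists_eq_range hIne
  have hf : ∀ k, f k ∈ frontier Ω := fun k => hIsub (mem_range_self k)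
  set A : ℕ → Set (Rd d) := fun k => φ (f k) '' S (f k) with hA
  have hφc : ∀ k, ContinuousOn (φ (f k)) (S (f k)) := fun k => (hφC _ (hf k)).continuousOn
  have hAm : ∀ k, MeasurableSet (A k) := fun k =>
    (hSo _ (hf k)).measurableSet.image_of_continuousOn_injOn (hφc k) (hφi _ (hf k))
  -- The chart images are made disjoint on the boundary, hence also in the layer by injectivity of
  -- normal coordinates. Summing over the charts then needs no bound on the number of overlaps.
  set S' : ℕ → Set (TangentialSpace d) := fun k =>
    S (f k) ∩ φ (f k) ⁻¹' disjointed A k with hS'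
  have hS'm : ∀ k, MeasurableSet (S' k) := fun k =>
    measurableSet_inter_preimage_of_continuousOn (hSo _ (hf k)).measurableSet (hφc k)
      (MeasurableSet.disjointed hAm k)
  set Ψ : ℕ → Rd d → Rd d := fun k => normalCoordinateMap ν (φ (f k)) with hΨ
  have hcoord : ∀ k, ∀ y ∈ chartCylinder (S' k) τ₀,
      φ (f k) (tangentialPart y) ∈ frontier Ω ∧ y 0 ∈ Ioc 0 τ₀ := fun k y hy =>
    ⟨hφm _ (hf k) hy.1.1, hy.2⟩
  have hinj : ∀ k, InjOn (Ψ k) (chartCylinder (S' k) τ₀) := by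
    intro k y hy z hz hyz
    have h1 := hbij.injOn (mk_mem_prod (hcoord k y hy).1 (hcoord k y hy).2)
      (mk_mem_prod (hcoord k z hz).1 (hcoord k z hz).2) hyz
    have h2 := hφi _ (hf k) hy.1.1 hz.1.1 (congrArg Prod.fst h1)
    have h3 : y 0 = z 0 := congrArg Prod.snd h1
    ext i
    by_cases hi : i = 0
    · rw [hi, h3]
    · exact congrArg (fun s : TangentialSpace d => s ⟨i, hi⟩) h2
  have hlow : ∀ k, ∀ y ∈ chartCylinder (S' k) τ₀, c ≤ |(fderiv ℝ (Ψ k) y).det| := fun k y hy =>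
    (hJ _ (hf k) y hy.1.1 hy.2).2.1
  have hup : ∀ k, ∀ y ∈ chartCylinder (S' k) τ₀, |(fderiv ℝ (Ψ k) y).det| ≤ K := fun k y hy =>
    (hJ _ (hf k) y hy.1.1 hy.2).2.2
  have hsingle : ∀ k, ENNReal.ofReal (τ₀ / 2) *
      (ENNReal.ofReal c * ∫⁻ x in Ψ k '' chartCylinder (S' k) t, F x) ≤
      ENNReal.ofReal K * ENNReal.ofReal t * ∫⁻ x in Ψ k '' chartCylinder (S' k) τ₀, h x := by
    intro k
    refine lintegral_image_chartCylinder_le (hS'm k) hc (by linarith) (by positivity) (hinj k)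
      (hlow k) (hup k) hh fun y hy => ?_
    simp only [hΨ, normalCoordinateMap_add_smul]
    exact hF _ (hφm _ (hf k) hy.1.1) _ hy.2
  have hcover : boundaryLayer Ω t ⊆ ⋃ k, Ψ k '' chartCylinder (S' k) t := by
    intro x hx
    obtain ⟨hpos, q, hq, hqe⟩ := exists_eq_add_infDist_smul hΩ hne hν hx.1
    have hle := hx.2
    rw [infDist_frontier_eq hΩ hx.1 hne] at hle
    have hqA : q ∈ ⋃ k, disjointed A k := by
      rw [iUnion_disjointed]
      simpa [hA] using hIcov hq
    obtain ⟨k, hk⟩ := mem_iUnion.1 hqA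
    obtain ⟨s, hs, rfl⟩ := disjointed_subset A k hk
    refine mem_iUnion.2 ⟨k, ?_⟩
    set y : Rd d := WithLp.toLp 2 fun i =>
      if hi : i = 0 then Metric.infDist x Ωᶜ else s ⟨i, hi⟩ with hy
    have hy0 : y 0 = Metric.infDist x Ωᶜ := by simp [hy]
    have hys : tangentialPart y = s := by
      ext i
      simp [tangentialPart, hy, i.2]
    refine ⟨y, ⟨by rw [hys]; exact ⟨hs, hk⟩, by rw [hy0]; exact ⟨hpos, hle⟩⟩, ?_⟩
    simp only [hΨ, normalCoordinateMap, hys, hy0]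
    exact hqe.symm
  have hdisj : Pairwise (Function.onFun Disjoint fun k => Ψ k '' chartCylinder (S' k) τ₀) := by
    intro j k hjk
    refine disjoint_left.2 ?_
    rintro _ ⟨y, hy, rfl⟩ ⟨z, hz, hzy⟩
    have h1 := hbij.injOn (mk_mem_prod (hcoord k z hz).1 (hcoord k z hz).2)
      (mk_mem_prod (hcoord j y hy).1 (hcoord j y hy).2) hzy
    have h2 : φ (f k) (tangentialPart z) = φ (f j) (tangentialPart y) := congrArg Prod.fst h1
    refine disjoint_left.1 (disjoint_disjointed A hjk) hy.1.2 ?_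
    rw [← h2]
    exact hz.1.2
  have hΨc : ∀ k, ContinuousOn (Ψ k) (chartCylinder (S' k) τ₀) := fun k y hy =>
    (hasFDerivAt_of_det_ne_zero
      (abs_pos.1 (hc.trans_le (hlow k y hy)))).continuousAt.continuousWithinAt
  have him : ∀ k, MeasurableSet (Ψ k '' chartCylinder (S' k) τ₀) := fun k =>
    (measurableSet_chartCylinder (hS'm k) τ₀).image_of_continuousOn_injOn (hΨc k) (hinj k)
  calc ENNReal.ofReal (τ₀ / 2) * (ENNReal.ofReal c * ∫⁻ x in boundaryLayer Ω t, F x)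
      ≤ ENNReal.ofReal (τ₀ / 2) *
          (ENNReal.ofReal c * ∑' k, ∫⁻ x in Ψ k '' chartCylinder (S' k) t, F x) := by
        gcongr
        exact (lintegral_mono_set hcover).trans (lintegral_iUnion_le _ _)
    _ = ∑' k, ENNReal.ofReal (τ₀ / 2) *
          (ENNReal.ofReal c * ∫⁻ x in Ψ k '' chartCylinder (S' k) t, F x) := by
        simp only [ENNReal.tsum_mul_left]
    _ ≤ ∑' k, ENNReal.ofReal K * ENNReal.ofReal t *
          ∫⁻ x in Ψ k '' chartCylinder (S' k) τ₀, h x := ENNReal.tsum_le_tsum hsingle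
    _ = ENNReal.ofReal K * ENNReal.ofReal t *
          ∫⁻ x in ⋃ k, Ψ k '' chartCylinder (S' k) τ₀, h x := by
        rw [ENNReal.tsum_mul_left, lintegral_iUnion him hdisj]
    _ ≤ _ := by
        gcongr
        exact Measure.restrict_le_self

end Charts

/-! ### The `L₂` bound on a boundary strip. -/

section Layer

variable {d : ℕ} {Ω : Set (Rd d)}

theorem enorm_sq_le_two_mul_add {E : Type*} [NormedAddCommGroup E] (x y : E) :
    ‖x‖ₑ ^ 2 ≤ 2 * ‖y‖ₑ ^ 2 + 2 * ‖y - x‖ₑ ^ 2 := by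
  have h1 : ‖x‖ ≤ ‖y‖ + ‖y - x‖ := by
    have := norm_sub_le y (y - x)
    rwa [sub_sub_cancel] at this
  have h2 : ‖x‖ ^ 2 ≤ 2 * ‖y‖ ^ 2 + 2 * ‖y - x‖ ^ 2 := by
    nlinarith [norm_nonneg x, sq_nonneg (‖y‖ - ‖y - x‖), norm_nonneg y, norm_nonneg (y - x)]
  have h3 := ENNReal.ofReal_le_ofReal h2
  rw [ENNReal.ofReal_add (by positivity) (by positivity), ENNReal.ofReal_mul (by norm_num),
    ENNReal.ofReal_mul (by norm_num)] at h3
  simpa [ENNReal.ofReal_pow] using h3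

/-- A smooth function on a segment is controlled by its averages and those of its gradient. -/
theorem mul_enorm_sq_le_lintegral {n : ℕ} {w : Rd d → Cn n} (hw : ContDiff ℝ 1 w) (x e : Rd d)
    (he : ‖e‖ = 1) (a : ℝ) :
    ENNReal.ofReal a * ‖w x‖ₑ ^ 2 ≤
      ∫⁻ θ in Ioc 0 a, (2 * ‖w (x + θ • e)‖ₑ ^ 2 +
        2 * ENNReal.ofReal a ^ 2 * gradSq w (x + θ • e)) := by
  have hwc := hw.continuous
  have hgc := continuous_gradSq hw
  have hgm : Measurable fun η : ℝ => gradSq w (x + η • e) := (hgc.comp (by fun_prop)).measurable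
  have hwm : Measurable fun η : ℝ => 2 * ‖w (x + η • e)‖ₑ ^ 2 := by
    have : Continuous fun η : ℝ => w (x + η • e) := hwc.comp (by fun_prop)
    exact (this.measurable.enorm.pow_const 2).const_mul 2
  have he' : ‖e‖ₑ = 1 := by rw [← ofReal_norm, he, ENNReal.ofReal_one]
  set G := ∫⁻ η in Ioc 0 a, gradSq w (x + η • e) with hG
  -- The value at `x` is compared with the value at each `x + θ • e`, and the comparison is then
  -- integrated over `θ`.
  have hpt : ∀ θ ∈ Ioc 0 a, ‖w x‖ₑ ^ 2 ≤
      2 * ‖w (x + θ • e)‖ₑ ^ 2 + 2 * (ENNReal.ofReal a * G) := by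
    intro θ hθ
    refine (enorm_sq_le_two_mul_add (w x) (w (x + θ • e))).trans ?_
    gcongr
    refine (enorm_sub_sq_le_lintegral_gradSq hw x e hθ.1.le).trans ?_
    rw [he', one_pow, mul_one]
    gcongr
    · exact hθ.2
    · exact lintegral_mono_set (Ioc_subset_Ioc_right hθ.2)
  calc ENNReal.ofReal a * ‖w x‖ₑ ^ 2 = ∫⁻ _ in Ioc 0 a, ‖w x‖ₑ ^ 2 := by
        rw [setLIntegral_const, Real.volume_Ioc, sub_zero, mul_comm]
    _ ≤ ∫⁻ θ in Ioc 0 a, (2 * ‖w (x + θ • e)‖ₑ ^ 2 + 2 * (ENNReal.ofReal a * G)) :=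
        setLIntegral_mono' measurableSet_Ioc hpt
    _ = (∫⁻ θ in Ioc 0 a, 2 * ‖w (x + θ • e)‖ₑ ^ 2) + 2 * ENNReal.ofReal a ^ 2 * G := by
        rw [lintegral_add_left hwm, setLIntegral_const, Real.volume_Ioc, sub_zero]
        ring
    _ = _ := by
        rw [lintegral_add_left hwm, lintegral_const_mul _ hgm]

theorem iUnion_innerPart (hΩ : IsOpen Ω) :
    ⋃ m : ℕ, innerPart Ω (1 / ((m : ℝ) + 1)) = Ω := by
  refine subset_antisymm (iUnion_subset fun m => innerPart_subset (by positivity)) fun x hx => ?_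
  obtain ⟨r, hr, hrΩ⟩ := Metric.isOpen_iff.1 hΩ x hx
  obtain ⟨m, hm⟩ := exists_nat_one_div_lt hr
  exact mem_iUnion.2 ⟨m, mem_innerPart_iff.2 ((Metric.ball_subset_ball hm.le).trans hrΩ)⟩

/-- Monotone convergence along an exhaustion of `Ω`. It makes interior approximation sufficient for
an estimate up to the boundary. -/
theorem setLIntegral_le_of_forall_innerPart (hΩ : IsOpen Ω) {A : Set (Rd d)}
    (hAΩ : A ⊆ Ω) {F : Rd d → ℝ≥0∞} {B : ℝ≥0∞}
    (h : ∀ s > 0, ∫⁻ x in A ∩ innerPart Ω s, F x ≤ B) : ∫⁻ x in A, F x ≤ B := by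
  have hA : A = ⋃ m : ℕ, A ∩ innerPart Ω (1 / ((m : ℝ) + 1)) := by
    rw [← inter_iUnion, iUnion_innerPart hΩ, inter_eq_left.2 hAΩ]
  have hmono : Monotone fun m : ℕ => A ∩ innerPart Ω (1 / ((m : ℝ) + 1)) := fun i j hij =>
    inter_subset_inter_right _ (innerPart_anti (one_div_le_one_div_of_le (by positivity)
      (by gcongr)))
  rw [hA, setLIntegral_iUnion_of_directed _ hmono.directed_le]
  exact iSup_le fun m => h _ (by positivity)

theorem diff_innerPart_subset_boundaryLayer (hΩ : IsOpen Ω) (hne : Ω ≠ univ) (t : ℝ) :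
    Ω \ innerPart Ω t ⊆ boundaryLayer Ω t := by
  rintro x ⟨hx, hxt⟩
  rw [mem_innerPart_iff_le_infDist hne, not_le] at hxt
  exact ⟨hx, by rw [infDist_frontier_eq hΩ hx hne]; exact hxt.le⟩

/-- The `L₂`-norm of a Sobolev function over a boundary layer of width `t` is `O(√t)`. -/
theorem exists_lintegral_boundary_strip_le [NeZero d] (hΩ : IsOpen Ω) (hΩn : Ω.Nonempty)
    (hnc : (frontier Ω).Nonempty → HasUniformNormalCoordinates Ω) (n : ℕ) :
    ∃ C : ℝ, 0 ≤ C ∧ ∀ t > 0, ∀ u : SobolevFun Ω n,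
      ∫⁻ x in Ω \ innerPart Ω t, ‖u.toFun x‖ₑ ^ 2 ≤ ENNReal.ofReal (C * t * u.sobolevNorm ^ 2) := by
  by_cases hne : Ω = univ
  · refine ⟨0, le_rfl, fun t _ u => ?_⟩
    have : Ω \ innerPart Ω t = ∅ := by
      rw [sdiff_eq_empty]
      intro x _
      rw [mem_innerPart_iff, hne]
      exact subset_univ _
    simp [this]
  obtain ⟨a, ν, c, K, ha, hc, hν1, hdist, hest⟩ :=
    lintegral_boundaryLayer_le hΩ hne (hnc (nonempty_frontier_iff.2 ⟨hΩn, hne⟩))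
  -- The factor `2 + 2 * a ^ 2` comes from `mul_enorm_sq_le_lintegral`, and `K / (a * c)` from the
  -- chart estimate. The maximum makes nonnegativity evident without knowing the sign of `K`.
  set B : ℝ := max K 0 * (2 + 2 * a ^ 2) / (a * c) with hB
  have hB0 : 0 ≤ B := by positivity
  refine ⟨B + 1 / a, by positivity, fun t ht u => ?_⟩
  set N := u.sobolevNorm
  -- For a wide strip the full `L₂` norm is enough, since `t / a ≥ 1`; this is the summand `1 / a`
  -- of the constant.
  rcases lt_or_ge a t with hat | hta
  · calc ∫⁻ x in Ω \ innerPart Ω t, ‖u.toFun x‖ₑ ^ 2 ≤ ∫⁻ x in Ω, ‖u.toFun x‖ₑ ^ 2 :=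
          lintegral_mono_set sdiff_subset
      _ ≤ ENNReal.ofReal (N ^ 2) := u.lintegral_toFun_le
      _ ≤ _ := by
          refine ENNReal.ofReal_le_ofReal ?_
          have h1 : 1 ≤ 1 / a * t := by rw [one_div_mul_eq_div, le_div_iff₀ ha]; linarith
          have h2 : 1 ≤ (B + 1 / a) * t := by nlinarith
          exact le_mul_of_one_le_left (sq_nonneg _) h2
  refine le_trans ?_ (ENNReal.ofReal_le_ofReal
    (by gcongr; exact le_add_of_nonneg_right (by positivity) : B * t * N ^ 2 ≤ _))
  refine (lintegral_mono_set (diff_innerPart_subset_boundaryLayer hΩ hne t)).trans ?_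
  refine setLIntegral_le_of_forall_innerPart hΩ (fun x hx => hx.1) fun s hs => ?_
  obtain ⟨w, hw, hlim, hL, hG⟩ := u.exists_smooth_approx_gradSq hΩ
  have hDm := measurableSet_innerPart Ω s
  have hbound : ∀ᶠ k in atTop, ∫⁻ x in boundaryLayer Ω t ∩ innerPart Ω s, ‖w k x‖ₑ ^ 2 ≤
      ENNReal.ofReal (B * t * N ^ 2) := by
    filter_upwards [hG s hs] with k hk
    have hwc := (hw k).continuous
    have hgm := (continuous_gradSq (hw k)).measurable
    have hh : Measurable fun x => 2 * ‖w k x‖ₑ ^ 2 + 2 * ENNReal.ofReal a ^ 2 * gradSq (w k) x := by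
      fun_prop
    -- Both sides are cut off to `innerPart Ω s`, where the gradient of `w k` is controlled. The
    -- cut-off is compatible with averaging because inward motion along the normal never leaves
    -- `innerPart Ω s`.
    have h1 := hest t hta ((innerPart Ω s).indicator fun x => ‖w k x‖ₑ ^ 2)
      ((innerPart Ω s).indicator fun x =>
        2 * ‖w k x‖ₑ ^ 2 + 2 * ENNReal.ofReal a ^ 2 * gradSq (w k) x) (hh.indicator hDm) ?_
    · rw [setLIntegral_indicator hDm, inter_comm, lintegral_indicator hDm] at h1
      have h2 : ∫⁻ x in innerPart Ω s,
          (2 * ‖w k x‖ₑ ^ 2 + 2 * ENNReal.ofReal a ^ 2 * gradSq (w k) x) ≤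
          ENNReal.ofReal ((2 + 2 * a ^ 2) * N ^ 2) := by
        rw [lintegral_add_left (by fun_prop), lintegral_const_mul _ (by fun_prop),
          lintegral_const_mul _ hgm]
        calc _ ≤ 2 * ENNReal.ofReal (N ^ 2) + 2 * ENNReal.ofReal a ^ 2 * ENNReal.ofReal (N ^ 2) := by
              gcongr
              exact (setLIntegral_le_lintegral _ _).trans (hL k)
          _ = _ := by
              rw [ENNReal.ofReal_mul (by positivity), ENNReal.ofReal_add (by norm_num)
                (by positivity), ENNReal.ofReal_mul (by norm_num), ENNReal.ofReal_pow ha.le]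
              simp only [ENNReal.ofReal_ofNat]
              ring
      have h3 := h1.trans (mul_le_mul' le_rfl h2)
      have hac : ENNReal.ofReal (a * c) ≠ 0 := by
        rw [ENNReal.ofReal_ne_zero_iff]; positivity
      rw [← ENNReal.mul_le_mul_iff_right hac ENNReal.ofReal_ne_top,
        ← ENNReal.ofReal_mul (by positivity), ENNReal.ofReal_mul ha.le, mul_assoc]
      refine h3.trans ?_
      rw [show ENNReal.ofReal K = ENNReal.ofReal (max K 0) by simp, ← ENNReal.ofReal_mul (le_max_right _ _), ← ENNReal.ofReal_mul (by positivity)]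
      refine ENNReal.ofReal_le_ofReal (le_of_eq ?_)
      rw [hB]
      field_simp
    · intro p hp τ hτ
      by_cases hxs : p + τ • ν p ∈ innerPart Ω s
      · rw [indicator_of_mem hxs]
        refine (mul_enorm_sq_le_lintegral (hw k) _ (ν p) (hν1 p hp) a).trans ?_
        refine setLIntegral_mono' measurableSet_Ioc fun θ hθ => ?_
        have heq : p + τ • ν p + θ • ν p = p + (τ + θ) • ν p := by rw [add_smul, add_assoc]
        have hmem : p + (τ + θ) • ν p ∈ innerPart Ω s := by
          rw [mem_innerPart_iff_le_infDist hne] at hxs ⊢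
          rw [hdist p hp τ ⟨hτ.1, by linarith [hτ.2]⟩] at hxs
          rw [hdist p hp (τ + θ) ⟨add_pos hτ.1 hθ.1, by linarith [hτ.2, hθ.2]⟩]
          linarith [hθ.1]
        rw [heq, indicator_of_mem hmem]
      · simp [hxs]
  have hsub : boundaryLayer Ω t ∩ innerPart Ω s ⊆ Ω := fun x hx => hx.1.1
  calc ∫⁻ x in boundaryLayer Ω t ∩ innerPart Ω s, ‖u.toFun x‖ₑ ^ 2
      ≤ ∫⁻ x in boundaryLayer Ω t ∩ innerPart Ω s, liminf (fun k => ‖w k x‖ₑ ^ 2) atTop := by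
        refine lintegral_mono_ae ?_
        filter_upwards [ae_restrict_of_ae_restrict_of_subset hsub hlim] with x hx
        have h3 := ((ENNReal.continuous_pow 2).tendsto _).comp hx.enorm
        exact h3.liminf_eq.ge
    _ ≤ liminf (fun k => ∫⁻ x in boundaryLayer Ω t ∩ innerPart Ω s, ‖w k x‖ₑ ^ 2) atTop :=
        lintegral_liminf_le fun k => by
          have := (hw k).continuous
          fun_prop
    _ ≤ _ := (liminf_le_liminf hbound).trans_eq (by simp)

end Layer

/-! ### A bounded function against its average over small shifts. -/

section Averaging

variable {d : ℕ} {Ω : Set (Rd d)}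

/-- The shifted copies of the inner part differ from it only inside the boundary strip. -/
theorem enorm_setIntegral_sub_translate_le {M : ℝ} {F : Rd d → ℂ} {g : Rd d → ℝ≥0∞} {t : ℝ}
    {h : Rd d} (hΩ : IsOpen Ω) (ht : 0 < t) (hh : ‖h‖ ≤ t / 2) (hFi : Integrable F)
    (hF : ∀ x, ‖F x‖ₑ ≤ ENNReal.ofReal M * g x) (hF0 : ∀ x ∉ Ω, F x = 0) :
    ‖∫ x in innerPart Ω t, (F x - F (x + h))‖ₑ ≤
      ENNReal.ofReal M * ∫⁻ x in Ω \ innerPart Ω (2 * t), g x := by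
  have hDm := measurableSet_innerPart Ω t
  have hSm : MeasurableSet (Ω \ innerPart Ω (2 * t)) :=
    hΩ.measurableSet.diff (measurableSet_innerPart Ω _)
  have hFh : Integrable fun x => F (x + h) := hFi.comp_add_right h
  have hDh : MeasurableSet ((fun x => x - h) ⁻¹' innerPart Ω t) :=
    (measurable_id.sub_const h) hDm
  -- Translating the second term turns the expression into the integral of `F` against the
  -- difference of the indicators of `innerPart Ω t` and its translate by `h`. Both equal one on
  -- `innerPart Ω (2 * t)`, and `F` vanishes off `Ω`.
  have h1 : ∫ x in innerPart Ω t, (F x - F (x + h)) =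
      ∫ x, ((innerPart Ω t).indicator F x -
        ((fun x => x - h) ⁻¹' innerPart Ω t).indicator F x) := by
    rw [integral_sub hFi.integrableOn hFh.integrableOn, integral_sub (hFi.indicator hDm)
      (hFi.indicator hDh), integral_indicator hDm, ← integral_indicator (f := fun x => F (x + h)) hDm,
      ← integral_add_right_eq_self (((fun x => x - h) ⁻¹' innerPart Ω t).indicator F) h]
    congr 1
    refine integral_congr_ae (ae_of_all _ fun x => ?_)
    by_cases hx : x ∈ innerPart Ω t
    · have : x + h ∈ (fun x => x - h) ⁻¹' innerPart Ω t := by simpa using hx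
      simp only [indicator_of_mem hx, indicator_of_mem this]
    · have : x + h ∉ (fun x => x - h) ⁻¹' innerPart Ω t := by simpa using hx
      simp only [indicator_of_notMem hx, indicator_of_notMem this]
  rw [h1, ← lintegral_const_mul' _ _ (by simp), ← lintegral_indicator hSm]
  refine (enorm_integral_le_lintegral_enorm _).trans (lintegral_mono fun x => ?_)
  by_cases hxΩ : x ∈ Ω
  swap
  · have h2 : ∀ A : Set (Rd d), A.indicator F x = 0 := fun A => by
      by_cases hx : x ∈ A <;> simp [hx, hF0 x hxΩ]
    simp [h2]
  by_cases hx2 : x ∈ innerPart Ω (2 * t)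
  · have h2 : x ∈ innerPart Ω t := innerPart_anti (by linarith) hx2
    have h3 : x ∈ (fun x => x - h) ⁻¹' innerPart Ω t := by
      have := add_mem_innerPart (s := t) (h := -h) hx2 (by rw [norm_neg]; linarith)
      simpa [sub_eq_add_neg] using this
    rw [indicator_of_mem h2, indicator_of_mem h3]
    simp
  · have hxS : x ∈ Ω \ innerPart Ω (2 * t) := ⟨hxΩ, hx2⟩
    rw [indicator_of_mem hxS]
    refine le_trans ?_ (hF x)
    by_cases h2 : x ∈ innerPart Ω t <;>
      by_cases h3 : x ∈ (fun x => x - h) ⁻¹' innerPart Ω t <;>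
      simp only [indicator_of_mem, indicator_of_notMem, h2, h3, not_false_eq_true] <;> simp

/-- The difference between a bounded function and its average, tested against an integrable
function. -/
theorem norm_setIntegral_sub_average_le {M L T : ℝ} {f G : Rd d → ℂ} {t : ℝ}
    {Q : Measure (Rd d)} [IsProbabilityMeasure Q] (hΩ : IsOpen Ω) (ht : 0 < t) (hM : 0 ≤ M)
    (hL : 0 ≤ L) (hT : 0 ≤ T)
    (hQ : ∀ᵐ h ∂Q, ‖h‖ ≤ t / 2) (hf : StronglyMeasurable f) (hfM : ∀ x, ‖f x‖ ≤ M)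
    (hGi : Integrable G) (hG0 : ∀ x ∉ Ω, G x = 0)
    (hGL : ∫⁻ x in Ω \ innerPart Ω (2 * t), ‖G x‖ₑ ≤ ENNReal.ofReal L)
    (hGT : ∀ h : Rd d, ‖h‖ ≤ t / 2 →
      ∫⁻ x in innerPart Ω t, ‖G (x + h) - G x‖ₑ ≤ ENNReal.ofReal T) :
    ‖∫ x in innerPart Ω t, (f x - ∫ h, f (x + h) ∂Q) * G x‖ ≤ M * (L + T) := by
  have hfe : ∀ x, ‖f x‖ₑ ≤ ENNReal.ofReal M := fun x => by
    rw [← ofReal_norm]; exact ENNReal.ofReal_le_ofReal (hfM x)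
  have hfadd : StronglyMeasurable fun p : Rd d × Rd d => f (p.1 + p.2) :=
    hf.comp_measurable (by fun_prop)
  have hfx : ∀ x, Integrable (fun h => f (x + h)) Q := fun x =>
    (integrable_const M).mono' (hf.comp_measurable (by fun_prop)).aestronglyMeasurable
      (ae_of_all _ fun h => hfM _)
  -- As `Q` has mass one, `f x` may be moved under the average, and Fubini reduces the claim to a
  -- bound for each single shift.
  have hswap : ∫ x in innerPart Ω t, (f x - ∫ h, f (x + h) ∂Q) * G x =
      ∫ h, ∫ x in innerPart Ω t, (f x - f (x + h)) * G x ∂volume ∂Q := by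
    rw [← integral_integral_swap]
    · refine integral_congr_ae (ae_of_all _ fun x => ?_)
      simp only
      rw [integral_mul_const, integral_sub (integrable_const _) (hfx x)]
      simp
    · refine (hGi.integrableOn.comp_fst Q).bdd_mul (c := M + M)
        (f := fun p : Rd d × Rd d => f p.1 - f (p.1 + p.2)) ?_ ?_
      · exact ((hf.comp_measurable measurable_fst).sub hfadd).aestronglyMeasurable
      · exact ae_of_all _ fun p => (norm_sub_le _ _).trans (add_le_add (hfM _) (hfM _))
  rw [hswap]
  have hinner : ∀ᵐ h ∂Q, ‖∫ x in innerPart Ω t, (f x - f (x + h)) * G x‖ ≤ M * (L + T) := by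
    filter_upwards [hQ] with h hh
    have hfG : Integrable fun x => f x * G x :=
      hGi.bdd_mul (c := M) hf.aestronglyMeasurable (ae_of_all _ hfM)
    have hfGh : Integrable fun x => f (x + h) * G (x + h) := hfG.comp_add_right h
    have hfh : Integrable fun x => f (x + h) * (G (x + h) - G x) :=
      ((hGi.comp_add_right h).sub hGi).bdd_mul (c := M)
        (hf.comp_measurable (by fun_prop)).aestronglyMeasurable (ae_of_all _ fun x => hfM _)
    -- Discrete integration by parts: the difference is moved from `f`, which has no regularity,
    -- onto `G`.
    have hsplit : ∫ x in innerPart Ω t, (f x - f (x + h)) * G x =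
        (∫ x in innerPart Ω t, (f x * G x - f (x + h) * G (x + h))) +
          ∫ x in innerPart Ω t, f (x + h) * (G (x + h) - G x) := by
      have hsub : Integrable fun x => f x * G x - f (x + h) * G (x + h) := hfG.sub hfGh
      rw [← integral_add hsub.integrableOn hfh.integrableOn]
      refine integral_congr_ae (ae_of_all _ fun x => ?_)
      simp only
      ring
    have h1 := enorm_setIntegral_sub_translate_le (M := M) (F := fun x => f x * G x)
      (g := fun x => ‖G x‖ₑ) hΩ ht hh hfG
      (fun x => by rw [enorm_mul]; exact mul_le_mul' (hfe x) le_rfl)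
      (fun x hx => by simp [hG0 x hx])
    have h2 : ‖∫ x in innerPart Ω t, f (x + h) * (G (x + h) - G x)‖ₑ ≤
        ENNReal.ofReal M * ENNReal.ofReal T := by
      refine (enorm_integral_le_lintegral_enorm _).trans ?_
      refine le_trans (lintegral_mono fun x => ?_)
        ((lintegral_const_mul' (ENNReal.ofReal M) (fun x => ‖G (x + h) - G x‖ₑ)
          (by simp)).le.trans (mul_le_mul' le_rfl (hGT h hh)))
      rw [enorm_mul]
      exact mul_le_mul' (hfe _) le_rfl
    rw [hsplit, ← ENNReal.ofReal_le_ofReal_iff (by positivity), ofReal_norm]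
    refine (enorm_add_le _ _).trans ((add_le_add
      (h1.trans (mul_le_mul' le_rfl hGL)) h2).trans_eq ?_)
    rw [ENNReal.ofReal_mul hM, ENNReal.ofReal_add hL hT, mul_add]
  simpa using norm_integral_le_of_norm_le_const hinner

end Averaging

/-! ### Averages over `x + r ω` as integrals over random shifts. -/

section ScaledAverage

open ProbabilityTheory
open scoped Pointwise

variable {d : ℕ}

/-- The normalized Lebesgue measure on `r ω`. -/
noncomputable def scaledUniform (ω : Set (Rd d)) (r : ℝ) : Measure (Rd d) :=
  (ProbabilityTheory.cond volume ω).map fun z => r • z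

theorem isProbabilityMeasure_scaledUniform {ω : Set (Rd d)} (h0 : volume ω ≠ 0)
    (hfin : volume ω ≠ ∞) (r : ℝ) : IsProbabilityMeasure (scaledUniform ω r) := by
  have : IsProbabilityMeasure (ProbabilityTheory.cond volume ω) :=
    cond_isProbabilityMeasure_of_finite h0 hfin
  exact Measure.isProbabilityMeasure_map (by fun_prop)

theorem ae_scaledUniform {ω : Set (Rd d)} (hω : MeasurableSet ω) {r : ℝ} {p : Rd d → Prop}
    (hp : MeasurableSet {x | p x}) (h : ∀ z ∈ ω, p (r • z)) : ∀ᵐ x ∂(scaledUniform ω r), p x := by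
  rw [scaledUniform, ae_map_iff (by fun_prop) hp]
  filter_upwards [ae_cond_mem hω] with z hz
  exact h z hz

/-- The substitution `y = x + r • z` has Jacobian `r ^ d`. The average becomes an integral against a
probability measure independent of `x`, which is the form needed for Fubini. -/
theorem integral_scaledUniform {ω : Set (Rd d)} {r : ℝ} (hr : 0 < r) (f : Rd d → ℂ) (x : Rd d) :
    ∫ h, f (x + h) ∂(scaledUniform ω r) =
      ((r ^ d * volume.real ω : ℝ) : ℂ)⁻¹ * ∫ y in scaledSet ω r x, f y := by
  have himg : scaledSet ω r x = (fun w => x + w) '' (r • ω) := by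
    rw [scaledSet, ← image_smul, image_image]
  have hemb : MeasurableEmbedding fun z : Rd d => r • z :=
    measurableEmbedding_const_smul₀ hr.ne'
  rw [himg, (measurePreserving_add_left volume x).setIntegral_image_emb
    (measurableEmbedding_addLeft x) f, scaledUniform, hemb.integral_map, ProbabilityTheory.cond,
    integral_smul_measure, Measure.setIntegral_comp_smul_of_pos volume (fun w => f (x + w)) ω hr]
  simp only [finrank_euclideanSpace, Fintype.card_fin, measureReal_def, ENNReal.toReal_inv,
    Complex.real_smul]
  push_cast
  rw [mul_inv]
  ring

end ScaledAverage

/-! ### The estimate for one matrix entry. -/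

open scoped ComplexConjugate

section Entry

variable {d n : ℕ} {Ω : Set (Rd d)}

/-- A Sobolev function may be replaced by a strongly measurable one that vanishes outside `Ω`. -/
theorem SobolevFun.exists_representative (hΩ : IsOpen Ω) (u : SobolevFun Ω n) :
    ∃ u' : SobolevFun Ω n, StronglyMeasurable u'.toFun ∧ (∀ x ∉ Ω, u'.toFun x = 0) ∧
      MemLp u'.toFun 2 volume ∧ u'.toFun =ᵐ[volume.restrict Ω] u.toFun ∧
      u'.sobolevNorm = u.sobolevNorm := by
  obtain ⟨a, ham, hau, ha0, haL, -⟩ := exists_stronglyMeasurable_extension hΩ.measurableSet u.memLp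
  refine ⟨⟨a, u.grad, haL.restrict Ω, u.memLp_grad, fun i ψ h1 h2 h3 => ?_⟩, ham, ha0, haL, hau, ?_⟩
  · rw [← u.weakDeriv i ψ h1 h2 h3]
    refine integral_congr_ae ?_
    filter_upwards [hau] with x hx
    rw [hx]
  · have : ∫ x in Ω, ‖a x‖ ^ 2 = ∫ x in Ω, ‖u.toFun x‖ ^ 2 := by
      refine integral_congr_ae ?_
      filter_upwards [hau] with x hx
      rw [hx]
    simp only [SobolevFun.sobolevNorm, this]

/-- A measurable version is set to zero where it exceeds `M`. Averages of it over shifts are then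
defined, measurable and bounded by `M` at every point, even where the shifts leave `Ω`. -/
theorem exists_bounded_representative {f : Rd d → ℂ} {M : ℝ} (hM : 0 ≤ M)
    (hf : AEStronglyMeasurable f (volume.restrict Ω))
    (hfM : ∀ᵐ x ∂(volume.restrict Ω), ‖f x‖ ≤ M) :
    ∃ g : Rd d → ℂ, StronglyMeasurable g ∧ (∀ x, ‖g x‖ ≤ M) ∧ g =ᵐ[volume.restrict Ω] f := by
  have hset : MeasurableSet {x | ‖hf.mk f x‖ ≤ M} :=
    measurableSet_le hf.stronglyMeasurable_mk.norm.measurable measurable_const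
  refine ⟨{x | ‖hf.mk f x‖ ≤ M}.indicator (hf.mk f), hf.stronglyMeasurable_mk.indicator hset,
    fun x => ?_, ?_⟩
  · by_cases hx : x ∈ {x | ‖hf.mk f x‖ ≤ M}
    · rw [indicator_of_mem hx]; exact hx
    · rw [indicator_of_notMem hx, norm_zero]; exact hM
  · filter_upwards [hf.ae_eq_mk, hfM] with x h1 h2
    rw [h1] at h2
    rw [indicator_of_mem (show x ∈ {x | ‖hf.mk f x‖ ≤ M} from h2), h1]

theorem enorm_apply_le (x : Cn n) (i : Fin n) : ‖x i‖ₑ ≤ ‖x‖ₑ := by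
  rw [← ofReal_norm, ← ofReal_norm]
  exact ENNReal.ofReal_le_ofReal (PiLp.norm_apply_le x i)

theorem memLp_apply {α : Type*} [MeasurableSpace α] {μ : Measure α} {a : α → Cn n}
    (ha : MemLp a 2 μ) (i : Fin n) : MemLp (fun x => a x i) 2 μ := by
  refine ha.of_le ?_ (ae_of_all _ fun x => PiLp.norm_apply_le _ i)
  exact (EuclideanSpace.proj (𝕜 := ℂ) i).continuous.comp_aestronglyMeasurable ha.1

theorem integrable_apply_mul_conj {α : Type*} [MeasurableSpace α] {μ : Measure α} {a b : α → Cn n}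
    (ha : MemLp a 2 μ) (hb : MemLp b 2 μ) (i j : Fin n) :
    Integrable (fun x => a x j * conj (b x i)) μ := by
  have h1 := memLp_apply ha j
  have h2 : MemLp (fun x => conj (b x i)) 2 μ := (memLp_apply hb i).star
  exact h1.integrable_mul h2

theorem lintegral_apply_mul_conj_le {α : Type*} [MeasurableSpace α] {μ : Measure α} {a b : α → Cn n}
    (ha : AEStronglyMeasurable a μ) (hb : AEStronglyMeasurable b μ) {A B : ℝ} (hA : 0 ≤ A)
    (hB : 0 ≤ B) (h1 : ∫⁻ x, ‖a x‖ₑ ^ 2 ∂μ ≤ ENNReal.ofReal (A ^ 2))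
    (h2 : ∫⁻ x, ‖b x‖ₑ ^ 2 ∂μ ≤ ENNReal.ofReal (B ^ 2)) (i j : Fin n) :
    ∫⁻ x, ‖a x j * conj (b x i)‖ₑ ∂μ ≤ ENNReal.ofReal (A * B) := by
  refine le_trans (lintegral_mono fun x => ?_) (lintegral_mul_le_ofReal ha.enorm hb.enorm hA hB h1 h2)
  rw [enorm_mul, RCLike.enorm_conj]
  exact mul_le_mul' (enorm_apply_le _ _) (enorm_apply_le _ _)

theorem norm_integral_mul_le {α : Type*} [MeasurableSpace α] {μ : Measure α} {k G : α → ℂ} {c X : ℝ}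
    (hc : 0 ≤ c) (hX : 0 ≤ X) (hk : ∀ᵐ x ∂μ, ‖k x‖ ≤ c) (hG : ∫⁻ x, ‖G x‖ₑ ∂μ ≤ ENNReal.ofReal X) :
    ‖∫ x, k x * G x ∂μ‖ ≤ c * X := by
  rw [← ENNReal.ofReal_le_ofReal_iff (by positivity), ofReal_norm, ENNReal.ofReal_mul hc]
  refine (enorm_integral_le_lintegral_enorm _).trans ?_
  refine le_trans (lintegral_mono_ae ?_)
    ((lintegral_const_mul' (ENNReal.ofReal c) (fun x => ‖G x‖ₑ) (by simp)).le.trans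
      (mul_le_mul' le_rfl hG))
  filter_upwards [hk] with x hx
  rw [enorm_mul, ← ofReal_norm (k x)]
  exact mul_le_mul' (ENNReal.ofReal_le_ofReal hx) le_rfl

theorem SobolevFun.norm_integral_mul_le {W : Rd d → ℂ} {c : ℝ} (hc : 0 ≤ c)
    (hW : ∀ᵐ x ∂(volume.restrict Ω), ‖W x‖ ≤ c) (u v : SobolevFun Ω n) (i j : Fin n) :
    ‖∫ x in Ω, W x * (u.toFun x j * conj (v.toFun x i))‖ ≤ c * (u.sobolevNorm * v.sobolevNorm) :=
  Homog.norm_integral_mul_le hc (mul_nonneg u.sobolevNorm_nonneg v.sobolevNorm_nonneg) hW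
    (lintegral_apply_mul_conj_le u.memLp.1 v.memLp.1 u.sobolevNorm_nonneg v.sobolevNorm_nonneg
      u.lintegral_toFun_le v.lintegral_toFun_le i j)

theorem scaledSet_subset_of_mem_innerPart {ω : Set (Rd d)} {R r t : ℝ} (hr : 0 < r)
    (hR : ∀ z ∈ ω, ‖z‖ ≤ R) (ht : r * R < t) {x : Rd d} (hx : x ∈ innerPart Ω t) :
    scaledSet ω r x ⊆ Ω := by
  rintro _ ⟨z, hz, rfl⟩
  refine mem_innerPart_iff.1 hx ?_
  rw [Metric.mem_ball, dist_eq_norm, add_sub_cancel_left, norm_smul, Real.norm_of_nonneg hr.le]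
  exact (mul_le_mul_of_nonneg_left (hR z hz) hr.le).trans_lt ht

/-- The form of an oscillating coefficient minus its local average, for scalar coefficients. -/
theorem norm_integral_sub_limit_le (hΩ : IsOpen Ω) {C : ℝ} (hC : 0 ≤ C)
    (hlayer : ∀ t > 0, ∀ u : SobolevFun Ω n,
      ∫⁻ x in Ω \ innerPart Ω t, ‖u.toFun x‖ₑ ^ 2 ≤ ENNReal.ofReal (C * t * u.sobolevNorm ^ 2))
    {ω : Set (Rd d)} (hω : MeasurableSet ω) (hω0 : volume ω ≠ 0) (hωf : volume ω ≠ ∞) {R : ℝ}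
    (hR0 : 0 < R) (hR : ∀ z ∈ ω, ‖z‖ ≤ R) {r : ℝ} (hr : 0 < r) {ρ : ℝ} (hρ : 0 ≤ ρ) {M : ℝ}
    (hM : 0 ≤ M) {f f₀ : Rd d → ℂ} (hf : AEStronglyMeasurable f (volume.restrict Ω))
    (hfM : ∀ᵐ x ∂(volume.restrict Ω), ‖f x‖ ≤ M)
    (hf₀ : AEStronglyMeasurable f₀ (volume.restrict Ω))
    (hf₀M : ∀ᵐ x ∂(volume.restrict Ω), ‖f₀ x‖ ≤ M)
    (havg : ∀ᵐ x ∂(volume.restrict Ω), scaledSet ω r x ⊆ Ω →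
      ‖f₀ x - ((r ^ d * volume.real ω : ℝ) : ℂ)⁻¹ * ∫ y in scaledSet ω r x, f y‖ ≤ ρ)
    (u v : SobolevFun Ω n) (i j : Fin n) :
    ‖∫ x in Ω, (f x - f₀ x) * (u.toFun x j * conj (v.toFun x i))‖ ≤
      (ρ + M * (4 * C + 1) * (2 * R) * r) * (u.sobolevNorm * v.sobolevNorm) := by
  obtain ⟨u', hum, hu0, huL, huu, huN⟩ := u.exists_representative hΩ
  obtain ⟨v', hvm, hv0, hvL, hvv, hvN⟩ := v.exists_representative hΩ
  obtain ⟨g, hgm, hgM, hgf⟩ := exists_bounded_representative hM hf hfM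
  rw [← huN, ← hvN]
  set N := u'.sobolevNorm
  set N' := v'.sobolevNorm
  have hN : 0 ≤ N := u'.sobolevNorm_nonneg
  have hN' : 0 ≤ N' := v'.sobolevNorm_nonneg
  set G : Rd d → ℂ := fun x => u'.toFun x j * conj (v'.toFun x i) with hG
  have hGi : Integrable G := integrable_apply_mul_conj huL hvL i j
  have hG0 : ∀ x ∉ Ω, G x = 0 := fun x hx => by simp [hG, hu0 x hx]
  have h0 : ∫ x in Ω, (f x - f₀ x) * (u.toFun x j * conj (v.toFun x i)) =
      ∫ x in Ω, (g x - f₀ x) * G x := by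
    refine integral_congr_ae ?_
    filter_upwards [huu, hvv, hgf] with x h1 h2 h3
    simp only [hG, h1, h2, h3]
  -- Chosen so that every shift in `r ω` has length at most `r * R = t / 2`.
  set t := 2 * R * r with ht
  have ht0 : 0 < t := by positivity
  set D := innerPart Ω t with hD
  have hDm : MeasurableSet D := measurableSet_innerPart Ω t
  have hDΩ : D ⊆ Ω := innerPart_subset ht0
  -- Each of the two Sobolev factors contributes `√(C * s)`, so the product is of first order in
  -- `s`.
  have hstrip : ∀ s > 0, ∫⁻ x in Ω \ innerPart Ω s, ‖G x‖ₑ ≤ ENNReal.ofReal (C * s * (N * N')) := by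
    intro s hs
    have hCs : 0 ≤ C * s := by positivity
    have h1 := lintegral_apply_mul_conj_le (μ := volume.restrict (Ω \ innerPart Ω s))
      (A := √(C * s) * N) (B := √(C * s) * N') hum.aestronglyMeasurable hvm.aestronglyMeasurable
      (by positivity) (by positivity)
      (by rw [mul_pow, Real.sq_sqrt hCs]; exact hlayer s hs u')
      (by rw [mul_pow, Real.sq_sqrt hCs]; exact hlayer s hs v') i j
    refine h1.trans_eq ?_
    congr 1
    rw [mul_mul_mul_comm, Real.mul_self_sqrt hCs]
  -- Product rule: the increment of `G` splits into the increment of `u'` times the shifted `v'` and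
  -- `u'` times the increment of `v'`, each at most `‖h‖ * N * N'`; with `‖h‖ ≤ t / 2` the sum is at
  -- most `t * N * N'`.
  have htrans : ∀ h : Rd d, ‖h‖ ≤ t / 2 →
      ∫⁻ x in D, ‖G (x + h) - G x‖ₑ ≤ ENNReal.ofReal (t * (N * N')) := by
    intro h hh
    have hshift : ∀ w : SobolevFun Ω n,
        ∫⁻ x in D, ‖w.toFun (x + h)‖ₑ ^ 2 ≤ ENNReal.ofReal (w.sobolevNorm ^ 2) := by
      intro w
      refine (setLIntegral_comp_add_right_le hDm hΩ.measurableSet (fun x hx => ?_)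
        (fun x => ‖w.toFun x‖ₑ ^ 2)).trans w.lintegral_toFun_le
      exact innerPart_subset (by positivity : 0 < t / 2) (add_mem_innerPart hx (by linarith))
    have huh : StronglyMeasurable fun x => u'.toFun (x + h) :=
      hum.comp_measurable (by fun_prop)
    have hvh : StronglyMeasurable fun x => v'.toFun (x + h) :=
      hvm.comp_measurable (by fun_prop)
    have h1 := lintegral_apply_mul_conj_le (μ := volume.restrict D)
      (a := fun x => u'.toFun (x + h) - u'.toFun x) (b := fun x => v'.toFun (x + h))
      (huh.sub hum).aestronglyMeasurable hvh.aestronglyMeasurable (mul_nonneg (norm_nonneg h) hN) hN'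
      (u'.lintegral_translate_sub_le hΩ ht0 hh) (hshift v') i j
    have h2 := lintegral_apply_mul_conj_le (μ := volume.restrict D)
      (a := u'.toFun) (b := fun x => v'.toFun (x + h) - v'.toFun x)
      hum.aestronglyMeasurable (hvh.sub hvm).aestronglyMeasurable hN (mul_nonneg (norm_nonneg h) hN')
      ((lintegral_mono_set hDΩ).trans u'.lintegral_toFun_le)
      (v'.lintegral_translate_sub_le hΩ ht0 hh) i j
    calc ∫⁻ x in D, ‖G (x + h) - G x‖ₑ
        ≤ ∫⁻ x in D, (‖(u'.toFun (x + h) - u'.toFun x) j * conj (v'.toFun (x + h) i)‖ₑ +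
            ‖u'.toFun x j * conj ((v'.toFun (x + h) - v'.toFun x) i)‖ₑ) := by
          refine lintegral_mono fun x => ?_
          refine le_trans (le_of_eq ?_) (enorm_add_le _ _)
          congr 1
          simp only [hG, PiLp.sub_apply, map_sub]
          ring
      _ ≤ ENNReal.ofReal (‖h‖ * N * N') + ENNReal.ofReal (N * (‖h‖ * N')) := by
          rw [lintegral_add_left']
          · exact add_le_add h1 h2
          · exact (((EuclideanSpace.proj (𝕜 := ℂ) j).continuous.comp_stronglyMeasurable
              (huh.sub hum)).mul (Complex.continuous_conj.comp_stronglyMeasurable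
              ((EuclideanSpace.proj (𝕜 := ℂ) i).continuous.comp_stronglyMeasurable
                hvh))).aestronglyMeasurable.enorm
      _ ≤ ENNReal.ofReal (t * (N * N')) := by
          rw [← ENNReal.ofReal_add (by positivity) (by positivity)]
          refine ENNReal.ofReal_le_ofReal ?_
          nlinarith [mul_nonneg hN hN']
  set Q := scaledUniform ω r
  have hQp : IsProbabilityMeasure Q := isProbabilityMeasure_scaledUniform hω0 hωf r
  have hQ : ∀ᵐ h ∂Q, ‖h‖ ≤ t / 2 := by
    refine ae_scaledUniform hω (measurableSet_le (by fun_prop) measurable_const) fun z hz => ?_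
    rw [norm_smul, Real.norm_of_nonneg hr.le, ht]
    nlinarith [hR z hz]
  set A : Rd d → ℂ := fun x => ∫ h, g (x + h) ∂Q with hA
  have hAm : StronglyMeasurable A := by
    have : StronglyMeasurable fun p : Rd d × Rd d => g (p.1 + p.2) :=
      hgm.comp_measurable (by fun_prop)
    exact this.integral_prod_right
  have hAM : ∀ x, ‖A x‖ ≤ M := fun x => by
    simpa using norm_integral_le_of_norm_le_const (μ := Q) (ae_of_all _ fun h => hgM (x + h))
  have hAf : ∀ᵐ x ∂(volume.restrict D), ‖A x - f₀ x‖ ≤ ρ := by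
    filter_upwards [ae_restrict_of_ae_restrict_of_subset hDΩ havg, ae_restrict_mem hDm] with x hx hxD
    have hsub : scaledSet ω r x ⊆ Ω :=
      scaledSet_subset_of_mem_innerPart hr hR (by rw [ht]; nlinarith) hxD
    have heq : ∫ y in scaledSet ω r x, g y = ∫ y in scaledSet ω r x, f y :=
      integral_congr_ae (ae_restrict_of_ae_restrict_of_subset hsub hgf)
    have hAx : A x = ((r ^ d * volume.real ω : ℝ) : ℂ)⁻¹ * ∫ y in scaledSet ω r x, g y :=
      integral_scaledUniform hr g x
    rw [hAx, heq, norm_sub_rev]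
    exact hx hsub
  have hf₀D := hf₀.mono_measure (Measure.restrict_mono hDΩ le_rfl)
  have hi1 : IntegrableOn (fun x => (g x - f₀ x) * G x) Ω := by
    refine hGi.integrableOn.bdd_mul (c := M + M) (hgm.aestronglyMeasurable.sub hf₀) ?_
    filter_upwards [hf₀M] with x hx
    exact (norm_sub_le _ _).trans (add_le_add (hgM x) hx)
  have hi2 : IntegrableOn (fun x => (g x - A x) * G x) D :=
    hGi.integrableOn.bdd_mul (c := M + M) (hgm.sub hAm).aestronglyMeasurable
      (ae_of_all _ fun x => (norm_sub_le _ _).trans (add_le_add (hgM x) (hAM x)))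
  have hi3 : IntegrableOn (fun x => (A x - f₀ x) * G x) D :=
    hGi.integrableOn.bdd_mul (c := ρ) (hAm.aestronglyMeasurable.sub hf₀D) hAf
  have hsplit : ∫ x in Ω, (g x - f₀ x) * G x =
      (∫ x in D, (g x - A x) * G x) + (∫ x in D, (A x - f₀ x) * G x) +
        ∫ x in Ω \ D, (g x - f₀ x) * G x := by
    have h1 : ∫ x in D, (g x - f₀ x) * G x =
        (∫ x in D, (g x - A x) * G x) + ∫ x in D, (A x - f₀ x) * G x := by
      rw [← integral_add hi2 hi3]
      refine integral_congr_ae (ae_of_all _ fun x => ?_)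
      simp only
      ring
    rw [← h1, add_comm, ← setIntegral_union disjoint_sdiff_left hDm (hi1.mono_set sdiff_subset)
      (hi1.mono_set hDΩ), sdiff_union_of_subset hDΩ]
  have hNN : 0 ≤ N * N' := mul_nonneg hN hN'
  have b1 : ‖∫ x in D, (g x - A x) * G x‖ ≤ M * (C * (2 * t) * (N * N') + t * (N * N')) :=
    norm_setIntegral_sub_average_le hΩ ht0 hM (by positivity) (by positivity) hQ hgm hgM hGi hG0
      (hstrip _ (by positivity)) htrans
  have b2 : ‖∫ x in D, (A x - f₀ x) * G x‖ ≤ ρ * (N * N') := by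
    refine norm_integral_mul_le hρ hNN hAf ?_
    exact lintegral_apply_mul_conj_le hum.aestronglyMeasurable hvm.aestronglyMeasurable hN hN'
      ((lintegral_mono_set hDΩ).trans u'.lintegral_toFun_le)
      ((lintegral_mono_set hDΩ).trans v'.lintegral_toFun_le) i j
  have b3 : ‖∫ x in Ω \ D, (g x - f₀ x) * G x‖ ≤ (M + M) * (C * t * (N * N')) := by
    refine norm_integral_mul_le (by positivity) (by positivity) ?_ (hstrip t ht0)
    filter_upwards [ae_restrict_of_ae_restrict_of_subset sdiff_subset hf₀M] with x hx
    exact (norm_sub_le _ _).trans (add_le_add (hgM x) hx)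
  rw [h0, hsplit]
  -- The coefficient of `M * t` is `2 * C + 1` from averaging on `D` plus `2 * C` from the strip, in
  -- total `4 * C + 1`.
  calc _ ≤ M * (C * (2 * t) * (N * N') + t * (N * N')) + ρ * (N * N') +
        (M + M) * (C * t * (N * N')) := (norm_add₃_le).trans (by gcongr)
    _ = _ := by rw [ht]; ring

/-- A limit of local averages of uniformly bounded functions is measurable and bounded. -/
theorem limit_of_averages (hΩ : IsOpen Ω) {ω : Set (Rd d)} (hω0 : volume ω ≠ 0)
    (hωf : volume ω ≠ ∞) {R : ℝ} (hR : ∀ z ∈ ω, ‖z‖ ≤ R) {M : ℝ} (hM : 0 ≤ M) {r : ℕ → ℝ}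
    (hr : ∀ k, 0 < r k) (hr0 : Tendsto r atTop (𝓝 0)) {f : ℕ → Rd d → ℂ} {f₀ : Rd d → ℂ}
    (hf : ∀ k, AEStronglyMeasurable (f k) (volume.restrict Ω))
    (hfM : ∀ k, ∀ᵐ x ∂(volume.restrict Ω), ‖f k x‖ ≤ M)
    (hlim : ∀ᵐ x ∂(volume.restrict Ω), Tendsto (fun k =>
      ((r k ^ d * volume.real ω : ℝ) : ℂ)⁻¹ * ∫ y in scaledSet ω (r k) x, f k y) atTop
        (𝓝 (f₀ x))) :
    AEStronglyMeasurable f₀ (volume.restrict Ω) ∧ ∀ᵐ x ∂(volume.restrict Ω), ‖f₀ x‖ ≤ M := by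
  choose g hgm hgM hgf using fun k => exists_bounded_representative hM (hf k) (hfM k)
  set A : ℕ → Rd d → ℂ := fun k x => ∫ h, g k (x + h) ∂(scaledUniform ω (r k)) with hA
  have hQ : ∀ k, IsProbabilityMeasure (scaledUniform ω (r k)) := fun k =>
    isProbabilityMeasure_scaledUniform hω0 hωf (r k)
  have hAm : ∀ k, StronglyMeasurable (A k) := fun k => by
    have : StronglyMeasurable fun p : Rd d × Rd d => g k (p.1 + p.2) :=
      (hgm k).comp_measurable (by fun_prop)
    exact this.integral_prod_right
  have hAM : ∀ k x, ‖A k x‖ ≤ M := fun k x => by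
    simpa using norm_integral_le_of_norm_le_const (μ := scaledUniform ω (r k))
      (ae_of_all _ fun h => hgM k (x + h))
  -- For fixed `x` in the open set `Ω` the sets `x + r k ω` eventually lie in `Ω`, where `g k` and
  -- `f k` agree almost everywhere.
  have hAlim : ∀ᵐ x ∂(volume.restrict Ω), Tendsto (fun k => A k x) atTop (𝓝 (f₀ x)) := by
    filter_upwards [hlim, ae_restrict_mem hΩ.measurableSet] with x hx hxΩ
    refine hx.congr' ?_
    obtain ⟨s, hs, hsΩ⟩ := Metric.isOpen_iff.1 hΩ x hxΩ
    have hrR : Tendsto (fun k => r k * R) atTop (𝓝 0) := by simpa using hr0.mul_const R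
    filter_upwards [hrR.eventually_lt_const hs] with k hk
    have hsub : scaledSet ω (r k) x ⊆ Ω :=
      scaledSet_subset_of_mem_innerPart (hr k) hR hk (mem_innerPart_iff.2 hsΩ)
    rw [hA]
    simp only
    rw [integral_scaledUniform (hr k)]
    congr 1
    exact (integral_congr_ae (ae_restrict_of_ae_restrict_of_subset hsub (hgf k))).symm
  refine ⟨aestronglyMeasurable_of_tendsto_ae atTop (fun k => (hAm k).aestronglyMeasurable) hAlim, ?_⟩
  filter_upwards [hAlim] with x hx
  exact le_of_tendsto hx.norm (Eventually.of_forall fun k => hAM k x)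

end Entry

/-! ### From entries to the multiplier norm. -/

section Multiplier

variable {d n : ℕ} {Ω : Set (Rd d)}

theorem norm_le_matAbs (A : Mat n) (i j : Fin n) : ‖A i j‖ ≤ matAbs A := by
  calc ‖A i j‖ ≤ ∑ j', ‖A i j'‖ :=
        Finset.single_le_sum (f := fun j' => ‖A i j'‖) (fun _ _ => norm_nonneg _)
          (Finset.mem_univ j)
    _ ≤ matAbs A :=
        Finset.single_le_sum (f := fun i' => ∑ j', ‖A i' j'‖)
          (fun _ _ => Finset.sum_nonneg fun _ _ => norm_nonneg _) (Finset.mem_univ i)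

theorem matAbs_nonneg (A : Mat n) : 0 ≤ matAbs A :=
  Finset.sum_nonneg fun _ _ => Finset.sum_nonneg fun _ _ => norm_nonneg _

theorem ae_norm_le_of_linftyNorm_le {V : Rd d → Mat n} {M : ℝ≥0} (h : linftyNorm Ω V ≤ M)
    (i j : Fin n) : ∀ᵐ x ∂(volume.restrict Ω), ‖V x i j‖ ≤ M := by
  rw [linftyNorm, eLpNorm_exponent_top] at h
  filter_upwards [enorm_ae_le_eLpNormEssSup (fun x => matAbs (V x)) (volume.restrict Ω)] with x hx
  have h1 := hx.trans h
  rw [← ofReal_norm, Real.norm_of_nonneg (matAbs_nonneg _), ← ENNReal.ofReal_coe_nnreal] at h1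
  exact (norm_le_matAbs _ i j).trans ((ENNReal.ofReal_le_ofReal_iff M.2).1 h1)

theorem inner_toEuclideanLin (A : Mat n) (x y : Cn n) :
    inner ℂ y (Matrix.toEuclideanLin A x) = ∑ i, ∑ j, A i j * (x j * conj (y i)) := by
  simp only [PiLp.inner_apply, RCLike.inner_apply, Matrix.toLpLin_apply, Matrix.mulVec, dotProduct,
    Finset.sum_mul, mul_assoc]

theorem multiplierPairing_eq_sum {W : Rd d → Mat n} (hW : MemLinfty Ω W) (u v : SobolevFun Ω n) :
    multiplierPairing W u v =
      ∑ i, ∑ j, ∫ x in Ω, W x i j * (u.toFun x j * conj (v.toFun x i)) := by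
  have hint : ∀ i j, Integrable (fun x => W x i j * (u.toFun x j * conj (v.toFun x i)))
      (volume.restrict Ω) := fun i j =>
    (integrable_apply_mul_conj u.memLp v.memLp i j).mul_of_top_right (hW i j)
  rw [multiplierPairing]
  simp only [inner_toEuclideanLin]
  rw [integral_finsetSum _ fun i _ => integrable_finsetSum _ fun j _ => hint i j]
  exact Finset.sum_congr rfl fun i _ => integral_finsetSum _ fun j _ => hint i j

/-- A bound for the entries of the form gives a bound for the multiplier norm. -/
theorem multiplierNorm_le_of_entries (bc : BoundaryCondition) {W : Rd d → Mat n}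
    (hW : MemLinfty Ω W) {B : ℝ}
    (h : ∀ (u v : SobolevFun Ω n) i j,
      ‖∫ x in Ω, W x i j * (u.toFun x j * conj (v.toFun x i))‖ ≤
        B * (u.sobolevNorm * v.sobolevNorm)) :
    multiplierNorm Ω bc W ≤ ENNReal.ofReal ((n : ℝ) ^ 2 * B) := by
  refine iSup₂_le fun u _ => iSup₂_le fun v _ => iSup₂_le fun hu hv => ?_
  refine ENNReal.ofReal_le_ofReal ?_
  have hu' : 0 < u.sobolevNorm := lt_of_le_of_ne u.sobolevNorm_nonneg (Ne.symm hu)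
  have hv' : 0 < v.sobolevNorm := lt_of_le_of_ne v.sobolevNorm_nonneg (Ne.symm hv)
  rw [div_le_iff₀ (by positivity), multiplierPairing_eq_sum hW]
  calc _ ≤ ∑ i : Fin n, ∑ j : Fin n, B * (u.sobolevNorm * v.sobolevNorm) :=
        norm_sum_le_of_le _ fun i _ => norm_sum_le_of_le _ fun j _ => h u v i j
    _ = _ := by
        simp only [Finset.sum_const, Finset.card_univ, Fintype.card_fin, nsmul_eq_mul]
        ring

theorem MemLinfty.sub {V W : Rd d → Mat n} (hV : MemLinfty Ω V) (hW : MemLinfty Ω W) :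
    MemLinfty Ω fun x => V x - W x := fun i j => (hV i j).sub (hW i j)

theorem multiplierNorm_le_of_bounded (bc : BoundaryCondition) {W : Rd d → Mat n}
    (hW : MemLinfty Ω W) {M : ℝ} (hM : 0 ≤ M)
    (h : ∀ i j, ∀ᵐ x ∂(volume.restrict Ω), ‖W x i j‖ ≤ M) :
    multiplierNorm Ω bc W ≤ ENNReal.ofReal ((n : ℝ) ^ 2 * M) :=
  multiplierNorm_le_of_entries bc hW fun u v i j => u.norm_integral_mul_le hM (h i j) v i j

end Multiplier

end Homog

/-! ### The main theorem. -/

theorem theorem5 {d : ℕ} [NeZero d] {n m : ℕ}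
    (Ω : Set (Homog.Rd d)) (hΩ : Homog.IsDomainSet Ω)
    (hC2 : Homog.HasC2Boundary Ω)
    (hnormal : (frontier Ω).Nonempty → Homog.HasUniformNormalCoordinates Ω)
    (bc : Homog.BoundaryCondition)
    (ω : Set (Homog.Rd d)) (hω : Homog.IsDomainSet ω) (hωb : Bornology.IsBounded ω)
    (E : Set (EuclideanSpace ℝ (Fin m))) (hE0 : (0 : EuclideanSpace ℝ (Fin m)) ∉ E)
    (hE : (0 : EuclideanSpace ℝ (Fin m)) ∈ closure E)
    (V : EuclideanSpace ℝ (Fin m) → Homog.Rd d → Homog.Mat n)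
    (hV : ∀ ε ∈ E, Homog.MemLinfty Ω (V ε))
    (hVb : ∃ M : ℝ≥0, ∀ ε ∈ E, Homog.linftyNorm Ω (V ε) ≤ M) :
    ∃ C : ℝ, ∀ (μ ρ₂ : EuclideanSpace ℝ (Fin m) → ℝ) (V₀ : Homog.Rd d → Homog.Mat n),
      (∀ ε ∈ E, 0 < μ ε) → Tendsto μ (𝓝[E] 0) (𝓝 0) →
      (∀ ε ∈ E, 0 ≤ ρ₂ ε) → Tendsto ρ₂ (𝓝[E] 0) (𝓝 0) →
      (∀ᵐ x ∂(volume.restrict Ω),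
        Tendsto (fun ε => Homog.scaledAverage ω (μ ε) (V ε) x) (𝓝[E] 0) (𝓝 (V₀ x))) →
      (∀ ε ∈ E, ∀ᵐ x ∂(volume.restrict Ω), Homog.scaledSet ω (μ ε) x ⊆ Ω →
        Homog.matAbs (V₀ x - Homog.scaledAverage ω (μ ε) (V ε) x) ≤ ρ₂ ε) →
      Homog.MemLinfty Ω V₀ ∧
      Homog.ConvergesAsMultipliers Ω bc E V V₀ ∧
      ∀ ε ∈ E, Homog.multiplierNorm Ω bc (fun x => V ε x - V₀ x) ≤
        ENNReal.ofReal (C * (ρ₂ ε + μ ε ^ (1 / 2 : ℝ))) := by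
  obtain ⟨M, hM⟩ := hVb
  obtain ⟨C, hC, hlayer⟩ :=
    Homog.exists_lintegral_boundary_strip_le hΩ.1 hΩ.2.nonempty hnormal n
  obtain ⟨R, hR0, hR⟩ := hωb.exists_pos_norm_le
  have hω0 : volume ω ≠ 0 := (hω.1.measure_pos volume hω.2.nonempty).ne'
  have hωf : volume ω ≠ ∞ := hωb.measure_lt_top.ne
  have hVM := fun ε hε i j => Homog.ae_norm_le_of_linftyNorm_le (hM ε hε) i j
  set C' : ℝ := M * (4 * C + 1) * (2 * R) with hC'
  have hC'0 : 0 ≤ C' := by positivity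
  -- The factor `n ^ 2` counts entries; `1` serves `ρ₂`, `C'` the range `μ ≤ 1`, and `2 * M` the
  -- trivial bound for `μ ≥ 1`. The constant is fixed before `μ`, `ρ₂` and `V₀` appear.
  refine ⟨(n : ℝ) ^ 2 * (1 + C' + 2 * M), ?_⟩
  intro μ ρ₂ V₀ hμ hμ0 hρ hρ0 hlim havg
  -- Measurability of `V₀` is derived, not assumed: along a sequence in `E` tending to zero, `V₀` is
  -- an almost everywhere limit of measurable averages bounded by `M`.
  obtain ⟨e, heE, he0⟩ := mem_closure_iff_seq_limit.1 hE
  have he : Tendsto e atTop (𝓝[E] 0) :=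
    tendsto_nhdsWithin_iff.2 ⟨he0, Eventually.of_forall heE⟩
  have hV₀ : ∀ i j, AEStronglyMeasurable (fun x => V₀ x i j) (volume.restrict Ω) ∧
      ∀ᵐ x ∂(volume.restrict Ω), ‖V₀ x i j‖ ≤ M := by
    intro i j
    refine Homog.limit_of_averages hΩ.1 hω0 hωf hR M.2 (r := fun k => μ (e k))
      (fun k => hμ _ (heE k)) (hμ0.comp he) (f := fun k x => V (e k) x i j)
      (fun k => (hV _ (heE k) i j).1) (fun k => hVM _ (heE k) i j) ?_
    filter_upwards [hlim] with x hx
    exact ((continuous_id.matrix_elem i j).tendsto _).comp (hx.comp he)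
  have hV₀L : Homog.MemLinfty Ω V₀ := fun i j => memLp_top_of_bound (hV₀ i j).1 M (hV₀ i j).2
  have hbound : ∀ ε ∈ E, Homog.multiplierNorm Ω bc (fun x => V ε x - V₀ x) ≤
      ENNReal.ofReal ((n : ℝ) ^ 2 * (1 + C' + 2 * M) * (ρ₂ ε + μ ε ^ (1 / 2 : ℝ))) := by
    intro ε hε
    have hs0 : 0 ≤ μ ε ^ (1 / 2 : ℝ) := Real.rpow_nonneg (hμ ε hε).le _
    have hM0 : (0 : ℝ) ≤ M := M.2
    have hρε := hρ ε hε
    rw [mul_assoc]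
    refine Homog.multiplierNorm_le_of_entries bc ((hV ε hε).sub hV₀L)
      fun u v i j => ?_
    have hNN := mul_nonneg u.sobolevNorm_nonneg v.sobolevNorm_nonneg
    -- For `μ ≤ 1` the entry estimate, linear in `μ`, is weakened through `μ ≤ μ ^ (1 / 2)`.
    -- Otherwise `μ ^ (1 / 2) ≥ 1` absorbs the bound `2 * M`.
    rcases le_total (μ ε) 1 with h1 | h1
    · have h2 : μ ε ≤ μ ε ^ (1 / 2 : ℝ) := by
        simpa using Real.rpow_le_rpow_of_exponent_ge (hμ ε hε) h1 (by norm_num : (1 / 2 : ℝ) ≤ 1)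
      refine (Homog.norm_integral_sub_limit_le hΩ.1 hC hlayer hω.1.measurableSet hω0 hωf hR0 hR
        (hμ ε hε) hρε hM0 (hV ε hε i j).1 (hVM ε hε i j) (hV₀ i j).1 (hV₀ i j).2 ?_ u v i j).trans
        (mul_le_mul_of_nonneg_right ?_ hNN)
      · filter_upwards [havg ε hε] with x hx hsub
        exact (Homog.norm_le_matAbs _ i j).trans (hx hsub)
      · nlinarith [mul_nonneg hC'0 hρε, mul_nonneg hM0 hρε, mul_nonneg hM0 hs0,
          mul_le_mul_of_nonneg_left h2 hC'0]
    · have h2 : 1 ≤ μ ε ^ (1 / 2 : ℝ) := Real.one_le_rpow h1 (by norm_num)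
      refine (u.norm_integral_mul_le (W := fun x => V ε x i j - V₀ x i j) (c := M + M)
        (by positivity) ?_ v i j).trans (mul_le_mul_of_nonneg_right ?_ hNN)
      · filter_upwards [hVM ε hε i j, (hV₀ i j).2] with x hx hx0
        exact (norm_sub_le _ _).trans (add_le_add hx hx0)
      · nlinarith [mul_nonneg hC'0 hρε, mul_nonneg hM0 hρε, mul_nonneg hC'0 hs0,
          mul_le_mul_of_nonneg_left h2 hM0]
  refine ⟨hV₀L, ⟨fun ε hε => ?_, ?_, ?_⟩, hbound⟩
  · exact (Homog.multiplierNorm_le_of_bounded bc (hV ε hε) M.2 (hVM ε hε)).trans_lt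
      ENNReal.ofReal_lt_top
  · exact (Homog.multiplierNorm_le_of_bounded bc hV₀L M.2 fun i j => (hV₀ i j).2).trans_lt
      ENNReal.ofReal_lt_top
  · refine tendsto_of_tendsto_of_tendsto_of_le_of_le' tendsto_const_nhds ?_
      (Eventually.of_forall fun _ => zero_le) (eventually_mem_nhdsWithin.mono hbound)
    have h1 : Tendsto (fun ε => μ ε ^ (1 / 2 : ℝ)) (𝓝[E] 0) (𝓝 0) := by
      simpa using hμ0.rpow_const (p := 1 / 2) (Or.inr (by norm_num))
    have h2 := (hρ0.add h1).const_mul ((n : ℝ) ^ 2 * (1 + C' + 2 * M))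
    simpa using ENNReal.tendsto_ofReal h2
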